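/- Let $\mathbb{K}$ be a first-order structure expanding an ordered field; "definable" means definable in $\mathbb{K}$ with parameters, and $\mathbb{K}^n$ carries the topology of the distance $\max_i|x_i-y_i|$. Call a subset $X\subseteq\mathbb{K}^m$ *definably meager* (in $\mathbb{K}^m$) if there is a definable family $(A(t))_{t\in\mathbb{K}}$ of nowhere dense subsets of $\mathbb{K}^m$, increasing in $t$, with $X\subseteq\bigcup_t A(t)$. Assume that $\mathbb{K}$ is *definably complete* (every definable subset of $\mathbb{K}$ has a supremum in $\mathbb{K}\cup\{\pm\infty\}$) and *definably Baire* (no nonempty open definable subset of $\mathbb{K}$ is definably meager). Let $n\geq 1$ and let $U\subseteq\mathbb{K}^n$ be open, definable and definably connected (that is, not the union of two disjoint nonempty definable open subsets). Let $M$ be a *Noetherian differential ring* on $U$: a Noetherian ring, under pointwise operations, of definable $C^\infty$ functions $U\to\mathbb{K}$ that is closed under the partial derivatives $\partial/\partial x_i$ and contains $\mathbb{K}[x_1,\dots,x_n]$. Let $k,m\in\mathbb{N}$ with $k\leq n$, let $H=(h_1,\dots,h_{n-k})\in M^{n-k}$, and let $V:=V^{\mathrm{reg}}(H)$ be the set of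 regular zeros of $H$, i.e. the set of $x\in U$ with $H(x)=0$ at which the Jacobian matrix $DH(x)$ has maximal rank $n-k$; assume $V\neq\emptyset$. Let $F=(F_1,\dots,F_m)\in M^m$ and $f:=F|_V:V\to\mathbb{K}^m$. Let $\Delta_f\subseteq V$ be the set of singular points of $f$, i.e. the set of $x\in V$ at which the differential $DF(x)|_{T_xV}:T_xV\to\mathbb{K}^m$, with $T_xV=\ker DH(x)$, is not surjective, and let $\Sigma_f:=f(\Delta_f)$ be the set of singular values of $f$. Then $\Sigma_f$ is definably meager in $\mathbb{K}^m$. -/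

import Mathlib

open Set Filter Topology

universe u v w

namespace DefBaire

/-! ### Definability

Throughout, `K` is the underlying ordered field of a first-order `L`-structure, with the order
topology; `K ^ n` is `Fin n → K` with the product topology, which is the topology of the distance
`max_i |x i - y i|`. -/

section Definability

variable (L : FirstOrder.Language.{u, v}) {K : Type w} [L.Structure K]

/-- "Definable" means definable with parameters from `K`. -/
def IsDefinable {ι : Type} (X : Set (ι → K)) : Prop :=
  (univ : Set K).Definable L X

/-- A function on a subset `U` of `K ^ n` is definable if its graph is. -/
def IsDefinableFun {n : ℕ} {U : Set (Fin n → K)} (g : U → K) : Prop :=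
  IsDefinable L {p : Fin n ⊕ Unit → K | ∃ x : U, p = Sum.elim (x : Fin n → K) (fun _ => g x)}

/-- A family of subsets of `K ^ m` indexed by `K` is definable if
`{(x, t) | x ∈ A t}` is definable. -/
def IsDefinableFamily {m : ℕ} (A : K → Set (Fin m → K)) : Prop :=
  IsDefinable L {p : Fin m ⊕ Unit → K | p ∘ Sum.inl ∈ A (p (Sum.inr ()))}

variable (K) in
/-- The `L`-structure `K` expands the ordered field `(K, +, ·, ≤)`, up to interdefinability:
addition, multiplication and the order are definable in it. -/
structure ExpandsOrderedField [Field K] [LinearOrder K] : Prop where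
  add : IsDefinable L {p : Fin 3 → K | p 0 + p 1 = p 2}
  mul : IsDefinable L {p : Fin 3 → K | p 0 * p 1 = p 2}
  le : IsDefinable L {p : Fin 2 → K | p 0 ≤ p 1}

variable (K) in
/-- Every definable subset of `K` has a supremum in `K ∪ {±∞}`. -/
def DefinablyComplete [LinearOrder K] : Prop :=
  ∀ S : Set K, IsDefinable L {p : Fin 1 → K | p 0 ∈ S} → S.Nonempty → BddAbove S →
    ∃ a, IsLUB S a

/-- A definable set is definably connected if it is not the union of two definable nonempty
disjoint (relatively) open subsets. -/
def DefinablyConnected [TopologicalSpace K] {n : ℕ} (X : Set (Fin n → K)) : Prop :=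
  ¬ ∃ A B : Set (Fin n → K), IsDefinable L A ∧ IsDefinable L B ∧ A.Nonempty ∧ B.Nonempty ∧
    Disjoint A B ∧ (∃ O, IsOpen O ∧ A = O ∩ X) ∧ (∃ O, IsOpen O ∧ B = O ∩ X) ∧ A ∪ B = X

/-- `X` is definably meager in `K ^ m`: it is covered by a definable increasing family,
indexed by `K`, of nowhere dense sets.  The set `X` itself need not be definable. -/
def DefinablyMeager [LinearOrder K] [TopologicalSpace K] {m : ℕ} (X : Set (Fin m → K)) : Prop :=
  ∃ A : K → Set (Fin m → K), IsDefinableFamily L A ∧ Monotone A ∧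
    (∀ t, IsNowhereDense (A t)) ∧ X ⊆ ⋃ t, A t

variable (K) in
/-- `K` is definably Baire: no nonempty open definable subset of `K = K ^ 1` is
definably meager. -/
def DefinablyBaire [LinearOrder K] [TopologicalSpace K] : Prop :=
  ∀ O : Set (Fin 1 → K), IsOpen O → IsDefinable L O → O.Nonempty → ¬ DefinablyMeager L O

end Definability

/-! ### Differential calculus on an open subset of `K ^ n` -/

section Calculus

variable {K : Type w} [Field K] [TopologicalSpace K] {n : ℕ} {U : Set (Fin n → K)}

/-- The difference quotient `(g (x + t e_i) - g x) / t`.  The function `g` is extended by `0`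
outside `U`; when `U` is open this does not affect limits as `t → 0`. -/
noncomputable def diffQuot (g : U → K) (i : Fin n) (x : U) (t : K) : K :=
  (Function.extend Subtype.val g 0 ((x : Fin n → K) + Pi.single i t) - g x) / t

/-- `∂g/∂x_i` exists at `x` and equals `d`. -/
def HasPartialDerivAt (g : U → K) (i : Fin n) (x : U) (d : K) : Prop :=
  Tendsto (diffQuot g i x) (𝓝[≠] 0) (𝓝 d)

/-- The partial derivative `∂g/∂x_i : U → K` (junk where it does not exist). -/
noncomputable def partialDeriv (g : U → K) (i : Fin n) : U → K :=
  fun x => limUnder (𝓝[≠] 0) (diffQuot g i x)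

theorem HasPartialDerivAt.partialDeriv_eq [LinearOrder K] [IsStrictOrderedRing K]
    [OrderTopology K] {g : U → K} {i : Fin n} {x : U} {d : K} (h : HasPartialDerivAt g i x d) :
    partialDeriv g i x = d :=
  Tendsto.limUnder_eq h

/-- `g` is `C^p`: all iterated partial derivatives of order at most `p` exist everywhere on `U`
and are continuous. -/
def IsC : ℕ → (U → K) → Prop
  | 0, g => Continuous g
  | p + 1, g => Continuous g ∧
      ∀ i, (∀ x, ∃ d, HasPartialDerivAt g i x d) ∧ IsC p (partialDeriv g i)

/-- `g` is `C^∞`. -/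
def IsSmooth (g : U → K) : Prop := ∀ p, IsC p g

/-- The Jacobian matrix of `G = (g_1, …, g_r) : U → K ^ r` at `x`. -/
noncomputable def jacobian {r : ℕ} (G : Fin r → U → K) (x : U) : Matrix (Fin r) (Fin n) K :=
  Matrix.of fun j i => partialDeriv (G j) i x

/-- The set of regular zeros of `G = (g_1, …, g_r)`: the zeros at which the Jacobian matrix has
maximal rank. -/
def regularZeros {r : ℕ} (G : Fin r → U → K) : Set U :=
  {x | (∀ j, G j x = 0) ∧ (jacobian G x).rank = min r n}

/-- The tangent space at `x` of the manifold of regular zeros of `H`: the kernel of the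
differential of `H` at `x`. -/
noncomputable def tangentSpace {r : ℕ} (H : Fin r → U → K) (x : U) : Submodule K (Fin n → K) :=
  LinearMap.ker (Matrix.toLin' (jacobian H x))

/-- The set of singular points of the restriction `f` of `F = (F_1, …, F_m)` to the manifold `V`
of regular zeros of `H`: the points of `V` at which the differential of `f`, from the tangent
space of `V` to `K ^ m`, is not surjective. -/
def singularPoints {r m : ℕ} (H : Fin r → U → K) (F : Fin m → U → K) : Set U :=
  {x | x ∈ regularZeros H ∧
    ¬ Function.Surjective ((Matrix.toLin' (jacobian F x)).domRestrict (tangentSpace H x))}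

/-- The set of singular values of the restriction of `F` to the regular zeros of `H`. -/
def singularValues {r m : ℕ} (H : Fin r → U → K) (F : Fin m → U → K) : Set (Fin m → K) :=
  (fun x => fun j => F j x) '' singularPoints H F

/-- A Noetherian differential ring of definable `C^∞` functions on `U`, containing
`K[x_1, …, x_n]`. -/
structure IsNoetherianDifferentialRing (L : FirstOrder.Language.{u, v}) [L.Structure K]
    (M : Subring (U → K)) : Prop where
  definable : ∀ g ∈ M, IsDefinableFun L g
  smooth : ∀ g ∈ M, IsSmooth g
  noetherian : IsNoetherianRing M
  partialDeriv_mem : ∀ g ∈ M, ∀ i, partialDeriv g i ∈ M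
  polynomial_mem : ∀ p : MvPolynomial (Fin n) K,
    (fun x : U => MvPolynomial.eval (x : Fin n → K) p) ∈ M

end Calculus

end DefBaire

/-! The proof is a Noetherian induction on ideals `I` of `M`: the values of `F` at the singular
points where `I` vanishes form a definably meager set. The case `I = ⊥` is the theorem.

Let `T` be the set of these points. If some function outside `I` vanishes on `T`, then `I` can be
enlarged. Otherwise `I` consists of all functions of `M` that vanish on `T`. Take generators `g` of
`I`, including `H`, and a point `x` of `T` where the differentials of `g` and `F` have maximal rank.
Since `x` is singular, these differentials have a basis at `x` that omits some `dF_l`; let `Φ` be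
the functions of this basis and `d` the square of a minor of `DΦ` with `d x ≠ 0`. Where `d ≠ 0` on
`T`, maximality puts `dF_l` and all `dg_b` in the span of the `dΦ_j`. Cramer's rule writes this as
the vanishing on `T` of functions of `M`, so the relations hold on all of `U` modulo the ideal `(g)`
(`exists_isClosedSystem`).

Hence, near a zero of `g` with `d ≠ 0`, the increments of `F_l` and of the `g_b` along a level set
of `Φ` satisfy a linear differential inequality with zero initial value, and a Gronwall argument
makes them vanish (`eventually_eq_zero_on`, `locally_constant`). So on `{g = 0, d ≠ 0}` the
component `F_l` is locally constant on the fibres of the other components of `F`. Closed bounded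
pieces of this set then have nowhere dense image (`isNowhereDense_image`), and these pieces form a
definable increasing exhaustion. The rest of `T` lies in `{d = 0}`, where the induction hypothesis
for `I + (d)` applies, because `d ∉ I`. -/

set_option linter.unusedSectionVars false

namespace DefBaire

/-! ### Definability of formulas, proved by instance resolution. -/

section Definability

variable (L : FirstOrder.Language.{u, v}) {K : Type w} [L.Structure K] {ι κ : Type}

/-- Definability of a predicate on tuples, as a class, so that instance resolution proves it. -/
class DefPred (φ : (ι → K) → Prop) : Prop where
  out : IsDefinable L {p | φ p}

/-- Definability of a function on tuples. -/
class DefFn (f : (ι → K) → K) : Prop where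
  out : (univ : Set K).DefinableFun L f

variable {L}

theorem IsDefinable.defPred {X : Set (ι → K)} (hX : IsDefinable L X) :
    DefPred L (fun p : ι → K => p ∈ X) := ⟨hX⟩

theorem DefPred.comp [Finite κ] {φ : (κ → K) → Prop} (h : DefPred L φ) (F : (ι → K) → κ → K)
    [hF : ∀ k, DefFn L (fun p => F p k)] : DefPred L (fun p => φ (F p)) :=
  ⟨Set.Definable.preimage_map (F := F) (fun k => (hF k).out) h.out⟩

instance DefFn.comp [Finite κ] (f : (κ → K) → K) [h : DefFn L f] (F : (ι → K) → κ → K)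
    [hF : ∀ k, DefFn L (fun p => F p k)] : DefFn L (fun p => f (F p)) :=
  ⟨Set.DefinableFun.comp (fun k => (hF k).out) h.out⟩

instance DefFn.proj (i : ι) : DefFn L (fun p : ι → K => p i) := ⟨by fun_prop⟩

theorem DefFn.reindex (f : (ι → K) → K) [h : DefFn L f] (s : ι → κ) :
    DefFn L (fun q : κ → K => f (fun i => q (s i))) := by
  have h' := h.out.preimage_comp (fun o : Option ι => o.map s)
  exact ⟨h'⟩

instance DefFn.const (c : K) : DefFn L (fun _ : ι → K => c) :=
  ⟨L.definableFun_const ι (mem_univ c)⟩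

instance DefPred.const (c : Prop) : DefPred L (fun _ : ι → K => c) := by
  by_cases hc : c
  · exact ⟨by simp [hc, IsDefinable]⟩
  · exact ⟨by simp [hc, IsDefinable]⟩

section Connectives

variable (φ ψ : (ι → K) → Prop) [hφ : DefPred L φ] [hψ : DefPred L ψ]

instance DefPred.and : DefPred L (fun p => φ p ∧ ψ p) := ⟨hφ.out.inter hψ.out⟩

instance DefPred.or : DefPred L (fun p => φ p ∨ ψ p) := ⟨hφ.out.union hψ.out⟩

instance DefPred.not : DefPred L (fun p => ¬ φ p) := ⟨hφ.out.compl⟩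

instance DefPred.imp : DefPred L (fun p => φ p → ψ p) := by
  simp only [imp_iff_not_or]
  infer_instance

instance DefPred.iff : DefPred L (fun p => φ p ↔ ψ p) := by
  simp only [iff_def]
  infer_instance

end Connectives

instance DefPred.existsTuple [Finite κ] (φ : (ι → K) → (κ → K) → Prop)
    [h : DefPred L (fun q : ι ⊕ κ → K => φ (fun i => q (Sum.inl i)) (fun k => q (Sum.inr k)))] :
    DefPred L (fun p => ∃ v, φ p v) :=
  ⟨h.out.exists_of_finite⟩

instance DefPred.forallTuple [Finite κ] (φ : (ι → K) → (κ → K) → Prop)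
    [h : DefPred L (fun q : ι ⊕ κ → K => φ (fun i => q (Sum.inl i)) (fun k => q (Sum.inr k)))] :
    DefPred L (fun p => ∀ v, φ p v) :=
  ⟨h.out.forall_of_finite⟩

instance DefPred.exists (φ : (ι → K) → K → Prop)
    [h : DefPred L (fun q : ι ⊕ Unit → K => φ (fun i => q (Sum.inl i)) (q (Sum.inr ())))] :
    DefPred L (fun p => ∃ t, φ p t) := by
  have := DefPred.existsTuple (κ := Unit) (fun p v => φ p (v ())) (h := h)
  refine ⟨?_⟩
  convert! this.out using 1
  ext p
  exact ⟨fun ⟨t, ht⟩ => ⟨fun _ => t, ht⟩, fun ⟨v, hv⟩ => ⟨v (), hv⟩⟩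

instance DefPred.forall (φ : (ι → K) → K → Prop)
    [h : DefPred L (fun q : ι ⊕ Unit → K => φ (fun i => q (Sum.inl i)) (q (Sum.inr ())))] :
    DefPred L (fun p => ∀ t, φ p t) := by
  have := DefPred.forallTuple (κ := Unit) (fun p v => φ p (v ())) (h := h)
  refine ⟨?_⟩
  convert! this.out using 1
  ext p
  exact ⟨fun h v => h (v ()), fun h t => h (fun _ => t)⟩

instance DefPred.existsFinite {α : Type*} [Finite α] (φ : (ι → K) → α → Prop)
    [h : ∀ a, DefPred L (fun p => φ p a)] : DefPred L (fun p => ∃ a, φ p a) := by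
  refine ⟨?_⟩
  convert! Set.definable_iUnion_of_finite (fun a => (h a).out) using 1
  ext p
  simp

instance DefPred.forallFinite {α : Type*} [Finite α] (φ : (ι → K) → α → Prop)
    [h : ∀ a, DefPred L (fun p => φ p a)] : DefPred L (fun p => ∀ a, φ p a) := by
  refine ⟨?_⟩
  convert! Set.definable_iInter_of_finite (fun a => (h a).out) using 1
  ext p
  simp

instance DefPred.eq (f g : (ι → K) → K) [hf : DefFn L f] [hg : DefFn L g] :
    DefPred L (fun p => f p = g p) := ⟨hf.out.ofPred_eq hg.out⟩

theorem DefFn.of_graph (f : (ι → K) → K)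
    (h : DefPred L (fun q : ι ⊕ Unit → K => f (fun i => q (Sum.inl i)) = q (Sum.inr ()))) :
    DefFn L f := by
  -- The graph in `DefinableFun` is indexed by `Option ι`, with `none` for the value.
  have h' := h.out.preimage_comp (β := Option ι)
    (fun s : ι ⊕ Unit => Sum.elim some (fun _ => none) s)
  exact ⟨h'⟩

instance DefFn.ite (φ : (ι → K) → Prop) [DecidablePred φ] (f g : (ι → K) → K)
    [hφ : DefPred L φ] [hf : DefFn L f] [hg : DefFn L g] :
    DefFn L (fun p => if φ p then f p else g p) :=
  ⟨Set.DefinableFun.ite hφ.out hf.out hg.out⟩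

instance DefFn.update [DecidableEq κ] (x : (ι → K) → κ → K) (i k : κ) (t : (ι → K) → K)
    [hx : ∀ k, DefFn L (fun p => x p k)] [ht : DefFn L t] :
    DefFn L (fun p => Function.update (x p) i (t p) k) := by
  by_cases h : k = i
  · subst h; simpa using ht
  · simpa [h] using hx k

section Field

variable [Field K] [LinearOrder K] [hK : Fact (ExpandsOrderedField L K)]
variable (f g : (ι → K) → K) [hf : DefFn L f] [hg : DefFn L g]

instance DefPred.le : DefPred L (fun p => f p ≤ g p) := by
  have : ∀ k, DefFn L (fun p => ![f p, g p] k) := by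
    intro k; fin_cases k <;> simpa
  exact hK.out.le.defPred.comp (fun p => ![f p, g p])

instance DefPred.lt [IsStrictOrderedRing K] : DefPred L (fun p => f p < g p) := by
  simp only [← not_le]
  infer_instance

instance DefFn.add : DefFn L (fun p => f p + g p) := by
  apply DefFn.of_graph
  have : ∀ k, DefFn L (fun q : ι ⊕ Unit → K =>
      ![f (fun i => q (Sum.inl i)), g (fun i => q (Sum.inl i)), q (Sum.inr ())] k) := by
    intro k; fin_cases k
    · exact DefFn.reindex f Sum.inl
    · exact DefFn.reindex g Sum.inl
    · exact DefFn.proj _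
  exact hK.out.add.defPred.comp (fun q : ι ⊕ Unit → K =>
      ![f (fun i => q (Sum.inl i)), g (fun i => q (Sum.inl i)), q (Sum.inr ())])

instance DefFn.mul : DefFn L (fun p => f p * g p) := by
  apply DefFn.of_graph
  have : ∀ k, DefFn L (fun q : ι ⊕ Unit → K =>
      ![f (fun i => q (Sum.inl i)), g (fun i => q (Sum.inl i)), q (Sum.inr ())] k) := by
    intro k; fin_cases k
    · exact DefFn.reindex f Sum.inl
    · exact DefFn.reindex g Sum.inl
    · exact DefFn.proj _
  exact hK.out.mul.defPred.comp (fun q : ι ⊕ Unit → K =>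
      ![f (fun i => q (Sum.inl i)), g (fun i => q (Sum.inl i)), q (Sum.inr ())])

instance DefFn.neg : DefFn L (fun p => - f p) := by
  simp only [← neg_one_mul (f _)]
  infer_instance

instance DefFn.sub : DefFn L (fun p => f p - g p) := by
  simp only [sub_eq_add_neg]
  infer_instance

instance DefFn.abs [IsStrictOrderedRing K] : DefFn L (fun p => |f p|) := by
  have : (fun p => |f p|) = fun p => if 0 ≤ f p then f p else - f p := by
    ext p
    split_ifs with h
    · exact abs_of_nonneg h
    · exact abs_of_neg (not_le.1 h)
  rw [this]
  infer_instance

end Field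

end Definability

/-! ### One-variable analysis and compactness of boxes from definable completeness. -/

section Complete

variable {L : FirstOrder.Language.{u, v}} {K : Type w} [L.Structure K]
  [Field K] [LinearOrder K] [IsStrictOrderedRing K] [hK : Fact (ExpandsOrderedField L K)]

/-- Cousin's lemma: a definable property of intervals that is additive and holds locally holds
globally. -/
theorem DefinablyComplete.interval_induction (hc : DefinablyComplete L K) (Q : K → K → Prop)
    {a b : K} (hQ : DefPred L (fun p : Unit → K => Q a (p ()))) (hab : a ≤ b)
    (htrans : ∀ u v w, u ≤ v → v ≤ w → Q u v → Q v w → Q u w)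
    (hloc : ∀ t, a ≤ t → t ≤ b → ∃ δ > 0, ∀ u v, a ≤ u → u ≤ t → t ≤ v → v ≤ b →
      t - δ < u → v < t + δ → Q u v) : Q a b := by
  have hdef : IsDefinable L {p : Fin 1 → K | p 0 ∈ {t | a ≤ t ∧ t ≤ b ∧ Q a t}} := by
    have h1 : DefPred L (fun p : Fin 1 → K => Q a (p 0)) := hQ.comp (fun p _ => p 0)
    exact (inferInstance : DefPred L (fun p : Fin 1 → K => a ≤ p 0 ∧ p 0 ≤ b ∧ Q a (p 0))).out
  have haa : Q a a := by
    obtain ⟨δ, hδ, h⟩ := hloc a le_rfl hab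
    exact h a a le_rfl le_rfl le_rfl hab (by linarith) (by linarith)
  obtain ⟨c, hcl⟩ := hc _ hdef ⟨a, le_rfl, hab, haa⟩ ⟨b, fun t ht => ht.2.1⟩
  have hac : a ≤ c := hcl.1 ⟨le_rfl, hab, haa⟩
  have hcb : c ≤ b := hcl.2 fun t ht => ht.2.1
  obtain ⟨δ, hδ, h⟩ := hloc c hac hcb
  have hQc : Q a c := by
    obtain ⟨s, hs, hcs⟩ : ∃ s ∈ {t | a ≤ t ∧ t ≤ b ∧ Q a t}, c - δ < s := by
      by_contra! hcon
      have := hcl.2 hcon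
      linarith
    have hsc := hcl.1 hs
    exact htrans a s c hs.1 hsc hs.2.2 (h s c hs.1 hsc le_rfl hcb hcs (by linarith))
  rcases hcb.eq_or_lt with rfl | hlt
  · exact hQc
  · exfalso
    have h1 : c < min b (c + δ / 2) := lt_min hlt (by linarith)
    have h2 : Q c (min b (c + δ / 2)) :=
      h _ _ hac le_rfl h1.le (min_le_left _ _) (by linarith)
        ((min_le_right _ _).trans_lt (by linarith))
    exact absurd (hcl.1 ⟨hac.trans h1.le, min_le_left _ _, htrans _ _ _ hac h1.le hQc h2⟩)
      (not_le.2 h1)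

/-- For each `ε > 0` the bound `|f v - f u| ≤ (B + ε) * (v - u)` is additive in the interval and
holds on small intervals around any point, so Cousin's lemma applies; then `ε` tends to zero. No
derivative is needed, only local bounds on slopes. -/
theorem DefinablyComplete.mean_value_inequality (hc : DefinablyComplete L K) (f : K → K)
    (hf : DefFn L (fun p : Unit → K => f (p ()))) {a b : K} (hab : a ≤ b) (B : K)
    (h : ∀ t, a ≤ t → t ≤ b → ∀ ε > 0, ∃ δ > 0, ∀ s, a ≤ s → s ≤ b → |s - t| < δ →
      |f s - f t| ≤ (B + ε) * |s - t|) : |f b - f a| ≤ B * (b - a) := by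
  have key : ∀ ε > 0, |f b - f a| ≤ (B + ε) * (b - a) := by
    intro ε hε
    refine hc.interval_induction (fun u v => |f v - f u| ≤ (B + ε) * (v - u)) ?_ hab ?_ ?_
    · infer_instance
    · intro u v w _ _ h1 h2
      calc |f w - f u| = |(f w - f v) + (f v - f u)| := by ring_nf
        _ ≤ _ := abs_add_le _ _
        _ ≤ _ := add_le_add h2 h1
        _ = _ := by ring
    · intro t hat htb
      obtain ⟨δ, hδ, hd⟩ := h t hat htb ε hε
      refine ⟨δ, hδ, fun u v hau hut htv hvb h1 h2 => ?_⟩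
      have e1 := hd u hau (hut.trans htb) (by rw [abs_lt]; constructor <;> linarith)
      have e2 := hd v (hat.trans htv) hvb (by rw [abs_lt]; constructor <;> linarith)
      rw [abs_sub_comm (f u), abs_sub_comm u, abs_of_nonneg (sub_nonneg.2 hut)] at e1
      rw [abs_of_nonneg (sub_nonneg.2 htv)] at e2
      calc |f v - f u| = |(f v - f t) + (f t - f u)| := by ring_nf
        _ ≤ _ := abs_add_le _ _
        _ ≤ _ := add_le_add e2 e1
        _ = _ := by ring
  rcases hab.eq_or_lt with rfl | hlt
  · simp
  refine le_of_forall_pos_le_add fun ε hε => ?_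
  have hpos : 0 < b - a := sub_pos.2 hlt
  have := key (ε / (b - a)) (div_pos hε hpos)
  rwa [add_mul, div_mul_cancel₀ _ hpos.ne'] at this

/-- If `f` had no zero, its sign would be locally constant, and "same sign at both ends" would
spread from small intervals to `[a, b]`. -/
theorem DefinablyComplete.intermediate_value (hc : DefinablyComplete L K) (f : K → K)
    (hf : DefFn L (fun p : Unit → K => f (p ()))) {a b : K} (hab : a ≤ b)
    (h : ∀ t, a ≤ t → t ≤ b → ∀ ε > 0, ∃ δ > 0, ∀ s, a ≤ s → s ≤ b → |s - t| < δ →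
      |f s - f t| < ε) (ha : f a < 0) (hb : 0 < f b) : ∃ t, a ≤ t ∧ t ≤ b ∧ f t = 0 := by
  by_contra! hne
  have : (0 < f a ↔ 0 < f b) := by
    refine hc.interval_induction (fun u v => (0 < f u ↔ 0 < f v)) ?_ hab ?_ ?_
    · infer_instance
    · intro u v w _ _ h1 h2
      exact h1.trans h2
    · intro t hat htb
      have h0 := hne t hat htb
      obtain ⟨δ, hδ, hd⟩ := h t hat htb |f t| (abs_pos.2 h0)
      have aux : ∀ s, a ≤ s → s ≤ b → |s - t| < δ → (0 < f s ↔ 0 < f t) := by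
        intro s h1 h2 h3
        have h4 := abs_lt.1 (hd s h1 h2 h3)
        rcases lt_or_gt_of_ne h0 with h5 | h5
        · rw [abs_of_neg h5] at h4
          constructor <;> intro <;> linarith
        · rw [abs_of_pos h5] at h4
          constructor <;> intro <;> linarith
      refine ⟨δ, hδ, fun u v hau hut htv hvb h1 h2 => ?_⟩
      exact (aux u hau (hut.trans htb) (by rw [abs_lt]; constructor <;> linarith)).trans
        (aux v (hat.trans htv) hvb (by rw [abs_lt]; constructor <;> linarith)).symm
  exact absurd (this.2 hb) (not_lt.2 ha.le)

/-- Compactness of boxes: a definable property of boxes that passes to subsets and to unions of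
two sets and that holds locally holds for all boxes. -/
theorem DefinablyComplete.box_induction (hc : DefinablyComplete L K) {n : ℕ}
    (P : Set (Fin n → K) → Prop)
    (hP : DefPred L (fun p : Fin n ⊕ Fin n → K =>
      P (Icc (fun i => p (Sum.inl i)) (fun i => p (Sum.inr i)))))
    (hmono : ∀ X Y, X ⊆ Y → P Y → P X) (hunion : ∀ X Y, P X → P Y → P (X ∪ Y))
    (hloc : ∀ x : Fin n → K, ∃ δ > 0, P (Icc (fun i => x i - δ) (fun i => x i + δ)))
    (u v : Fin n → K) : P (Icc u v) := by
  classical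
  -- Tube lemma, one coordinate at a time: the coordinates in `s` already run through their whole
  -- interval, the others stay within `δ` of `x`.
  have claim : ∀ s : Finset (Fin n), ∀ x : Fin n → K, ∃ δ > 0,
      P (Icc (fun i => if i ∈ s then u i else x i - δ)
        (fun i => if i ∈ s then v i else x i + δ)) := by
    intro s
    induction s using Finset.induction_on with
    | empty => simpa using hloc
    | insert a s has ih =>
      intro x
      let lo : K → K → Fin n → K := fun c δ i => if i = a then c else if i ∈ s then u i else x i - δ
      let hi : K → K → Fin n → K := fun d δ i => if i = a then d else if i ∈ s then v i else x i + δ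
      have hlo : ∀ c c' d d' δ δ', c' ≤ c → d ≤ d' → δ ≤ δ' →
          Icc (lo c δ) (hi d δ) ⊆ Icc (lo c' δ') (hi d' δ') := by
        intro c c' d d' δ δ' h1 h2 h3
        apply Icc_subset_Icc
        · intro i; dsimp only [lo]; split_ifs <;> linarith
        · intro i; dsimp only [hi]; split_ifs <;> linarith
      have key : ∀ t, ∃ δ > 0, P (Icc (lo (t - δ) δ) (hi (t + δ) δ)) := by
        intro t
        obtain ⟨δ, hδ, h⟩ := ih (Function.update x a t)
        refine ⟨δ, hδ, hmono _ _ (Icc_subset_Icc ?_ ?_) h⟩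
        · intro i
          dsimp only [lo]
          by_cases hi : i = a
          · subst hi; simp [has]
          · simp [hi]
        · intro i
          dsimp only [hi]
          by_cases hi : i = a
          · subst hi; simp [has]
          · simp [hi]
      have goal : ∃ δ > 0, P (Icc (lo (u a) δ) (hi (v a) δ)) := by
        rcases le_or_gt (u a) (v a) with hab | hab
        -- The thickness `δ` is quantified inside the property of intervals, so joining two
        -- intervals just takes the smaller thickness.
        · refine hc.interval_induction (fun c d => ∃ δ > 0, P (Icc (lo c δ) (hi d δ)))
            ?_ hab ?_ ?_
          · have : DefPred L (fun q : Unit ⊕ Unit → K =>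
                P (Icc (lo (u a) (q (Sum.inr ()))) (hi (q (Sum.inl ())) (q (Sum.inr ()))))) := by
              have hF : ∀ k, DefFn L (fun q : Unit ⊕ Unit → K =>
                  (Sum.elim (lo (u a) (q (Sum.inr ())))
                    (hi (q (Sum.inl ())) (q (Sum.inr ()))) : Fin n ⊕ Fin n → K) k) := by
                rintro (k | k)
                · simp only [Sum.elim_inl, lo]; infer_instance
                · simp only [Sum.elim_inr, hi]; infer_instance
              exact hP.comp (fun q : Unit ⊕ Unit → K =>
                (Sum.elim (lo (u a) (q (Sum.inr ())))
                    (hi (q (Sum.inl ())) (q (Sum.inr ()))) : Fin n ⊕ Fin n → K))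
            infer_instance
          · rintro c d e hcd hde ⟨δ, hδ, h1⟩ ⟨δ', hδ', h2⟩
            refine ⟨min δ δ', lt_min hδ hδ', hmono _ _ ?_ (hunion _ _ h1 h2)⟩
            intro y hy
            rcases le_total (y a) d with hyd | hyd
            · refine Or.inl (hlo c c d d (min δ δ') δ le_rfl le_rfl (min_le_left _ _) ?_)
              refine ⟨hy.1, fun i => ?_⟩
              by_cases hia : i = a
              · subst hia; simpa [hi] using hyd
              · simpa [hi, hia] using hy.2 i
            · refine Or.inr (hlo d d e e (min δ δ') δ' le_rfl le_rfl (min_le_right _ _) ?_)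
              refine ⟨fun i => ?_, hy.2⟩
              by_cases hia : i = a
              · subst hia; simpa [lo] using hyd
              · simpa [lo, hia] using hy.1 i
          · intro t _ _
            obtain ⟨δ, hδ, h⟩ := key t
            exact ⟨δ, hδ, fun c d _ _ _ _ h1 h2 =>
              ⟨δ, hδ, hmono _ _ (hlo _ _ _ _ _ _ h1.le h2.le le_rfl) h⟩⟩
        -- The interval of the coordinate `a` is empty here, so the box is empty and any true
        -- instance of `P` suffices.
        · obtain ⟨δ, hδ, h⟩ := key 0
          refine ⟨δ, hδ, hmono _ _ ?_ h⟩
          intro y hy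
          have h1 := hy.1 a
          have h2 := hy.2 a
          simp only [lo, hi, if_true] at h1 h2
          exact absurd (h1.trans h2) (not_le.2 hab)
      obtain ⟨δ, hδ, h⟩ := goal
      refine ⟨δ, hδ, hmono _ _ (Icc_subset_Icc ?_ ?_) h⟩
      · intro i
        dsimp only [lo]
        by_cases hi : i = a
        · subst hi; simp
        · simp [hi]
      · intro i
        dsimp only [hi]
        by_cases hi : i = a
        · subst hi; simp
        · simp [hi]
  obtain ⟨δ, -, h⟩ := claim Finset.univ u
  simpa using h

end Complete

/-! ### Neighbourhoods and continuity in terms of the maximum distance. -/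

section Topology

variable {K : Type w} [Field K] [LinearOrder K] [IsStrictOrderedRing K] [TopologicalSpace K]
  [OrderTopology K] {n : ℕ}

theorem mem_nhds_iff_abs {s : Set (Fin n → K)} {x : Fin n → K} :
    s ∈ 𝓝 x ↔ ∃ δ > 0, ∀ y, (∀ i, |y i - x i| < δ) → y ∈ s := by
  have hb : ∀ i, (𝓝 (x i)).HasBasis (fun ε : K => 0 < ε) (fun ε => {b | |b - x i| < ε}) :=
    fun i => nhds_basis_abs_sub_lt (x i)
  constructor
  · intro hs
    rw [nhds_pi, Filter.mem_pi'] at hs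
    obtain ⟨I, t, ht, hts⟩ := hs
    choose ε hε hεt using fun i => (hb i).mem_iff.1 (ht i)
    obtain ⟨δ, hδ, hδε⟩ : ∃ δ > 0, ∀ i, δ ≤ ε i := by
      rcases isEmpty_or_nonempty (Fin n) with he | hne
      · exact ⟨1, one_pos, fun i => he.elim i⟩
      · obtain ⟨i, hi⟩ := Finite.exists_min ε
        exact ⟨ε i, hε i, hi⟩
    exact ⟨δ, hδ, fun y hy => hts fun i _ => hεt i ((hy i).trans_le (hδε i))⟩
  · rintro ⟨δ, hδ, h⟩
    have : Set.pi univ (fun i => {b | |b - x i| < δ}) ∈ 𝓝 x :=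
      set_pi_mem_nhds finite_univ fun i _ => (hb i).mem_of_mem hδ
    exact mem_of_superset this fun y hy => h y fun i => hy i (mem_univ i)

theorem continuousWithinAt_iff_abs {f : (Fin n → K) → K} {s : Set (Fin n → K)} {x : Fin n → K} :
    ContinuousWithinAt f s x ↔
      ∀ ε > 0, ∃ δ > 0, ∀ y ∈ s, (∀ i, |y i - x i| < δ) → |f y - f x| < ε := by
  unfold ContinuousWithinAt
  rw [LinearOrderedAddCommGroup.tendsto_nhds]
  refine forall₂_congr fun ε _ => ?_
  rw [eventually_nhdsWithin_iff]
  exact mem_nhds_iff_abs.trans ⟨fun ⟨δ, hδ, h⟩ => ⟨δ, hδ, fun y hy hyx => h y hyx hy⟩,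
    fun ⟨δ, hδ, h⟩ => ⟨δ, hδ, fun y hyx hy => h y hy hyx⟩⟩

end Topology

/-! ### Images of closed bounded definable sets. -/

section Complete

variable {L : FirstOrder.Language.{u, v}} {K : Type w} [L.Structure K]
  [Field K] [LinearOrder K] [IsStrictOrderedRing K] [TopologicalSpace K] [OrderTopology K]
  [hK : Fact (ExpandsOrderedField L K)] {n m : ℕ}

/-- For `y` outside the image, "the distance from `F` to `y` has a positive lower bound on this part
of `C`" holds locally and passes to unions, hence holds on all of `C` by `box_induction`. -/
theorem DefinablyComplete.isClosed_image (hc : DefinablyComplete L K) {C : Set (Fin n → K)}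
    [hC : DefPred L (fun p => p ∈ C)] (hclosed : IsClosed C) {u v : Fin n → K} (hCuv : C ⊆ Icc u v)
    (F : Fin m → (Fin n → K) → K) [hF : ∀ i, DefFn L (F i)] (hcont : ∀ i, ContinuousOn (F i) C) :
    IsClosed ((fun x i => F i x) '' C) := by
  rw [← isOpen_compl_iff, isOpen_iff_mem_nhds]
  intro y hy
  have key : ∃ ε > 0, ∀ x ∈ Icc u v, x ∈ C → ∃ i, ε ≤ |F i x - y i| := by
    refine hc.box_induction (fun X => ∃ ε > 0, ∀ x ∈ X, x ∈ C → ∃ i, ε ≤ |F i x - y i|)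
      ?_ ?_ ?_ ?_ u v
    · simp only [mem_Icc, Pi.le_def, gt_iff_lt]
      have := hC
      have : ∀ {κ : Type} (G : (κ → K) → (Fin n → K)) [∀ k, DefFn L (fun p => G p k)],
        DefPred L (fun p => G p ∈ C) := fun G _ => hC.comp G
      infer_instance
    · rintro X Y hXY ⟨ε, hε, h⟩
      exact ⟨ε, hε, fun x hx => h x (hXY hx)⟩
    · rintro X Y ⟨ε, hε, h⟩ ⟨ε', hε', h'⟩
      refine ⟨min ε ε', lt_min hε hε', ?_⟩
      rintro x (hx | hx) hxC
      · obtain ⟨i, hi⟩ := h x hx hxC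
        exact ⟨i, (min_le_left _ _).trans hi⟩
      · obtain ⟨i, hi⟩ := h' x hx hxC
        exact ⟨i, (min_le_right _ _).trans hi⟩
    · intro x
      by_cases hx : x ∈ C
      · have hne : ∃ i, F i x ≠ y i := by
          by_contra! hcon
          exact hy ⟨x, hx, funext hcon⟩
        obtain ⟨i, hi⟩ := hne
        have hpos : 0 < |F i x - y i| := abs_pos.2 (sub_ne_zero.2 hi)
        obtain ⟨δ, hδ, h⟩ := continuousWithinAt_iff_abs.1 (hcont i x hx) _ (half_pos hpos)
        refine ⟨δ / 2, half_pos hδ, _, half_pos hpos, fun z hz hzC => ⟨i, ?_⟩⟩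
        have h1 := h z hzC fun j => by
          have := hz.1 j
          have := hz.2 j
          rw [abs_lt]
          constructor <;> linarith
        have h2 : |F i x - y i| ≤ |F i z - F i x| + |F i z - y i| := by
          rw [abs_sub_comm (F i z) (F i x)]
          calc |F i x - y i| = |(F i x - F i z) + (F i z - y i)| := by ring_nf
            _ ≤ _ := abs_add_le _ _
        linarith
      · obtain ⟨δ, hδ, h⟩ := mem_nhds_iff_abs.1 (hclosed.isOpen_compl.mem_nhds hx)
        refine ⟨δ / 2, half_pos hδ, 1, one_pos, fun z hz hzC => absurd hzC (h z fun j => ?_)⟩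
        have := hz.1 j
        have := hz.2 j
        rw [abs_lt]
        constructor <;> linarith
  obtain ⟨ε, hε, h⟩ := key
  refine mem_nhds_iff_abs.2 ⟨ε, hε, ?_⟩
  rintro z hz ⟨x, hx, rfl⟩
  obtain ⟨i, hi⟩ := h x (hCuv hx) hx
  exact absurd (hz i) (not_lt.2 hi)

/-- The image of a closed bounded definable set is nowhere dense if one component of the map is
locally constant on the fibres of the other components. -/
theorem DefinablyComplete.isNowhereDense_image (hc : DefinablyComplete L K) {C : Set (Fin n → K)}
    [hC : DefPred L (fun p => p ∈ C)] (hclosed : IsClosed C) {u v : Fin n → K} (hCuv : C ⊆ Icc u v)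
    (F : Fin m → (Fin n → K) → K) [hF : ∀ i, DefFn L (F i)] (hcont : ∀ i, ContinuousOn (F i) C)
    (l : Fin m) (hconst : ∀ x ∈ C, ∃ δ > 0, ∀ y ∈ C, (∀ i, |y i - x i| < δ) →
      (∀ i, i ≠ l → F i y = F i x) → F l y = F l x) :
    IsNowhereDense ((fun x i => F i x) '' C) := by
  unfold IsNowhereDense
  rw [(hc.isClosed_image hclosed hCuv F hcont).closure_eq]
  by_contra hne
  obtain ⟨y, hy⟩ := nonempty_iff_ne_empty.2 hne
  obtain ⟨ε, hε, hbox⟩ := mem_nhds_iff_abs.1 (mem_interior_iff_mem_nhds.1 hy)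
  -- On the fibre of the other components over `y`, every interval contains a subinterval missed by
  -- `F l`. For a union, shrink twice. Locally `F l` takes at most one value on this fibre, so one
  -- half of the interval is missed.
  have key : ∀ a b, a < b → ∃ a' b', a ≤ a' ∧ a' < b' ∧ b' ≤ b ∧
      ∀ x ∈ Icc u v, x ∈ C → (∀ i, i ≠ l → F i x = y i) → ¬ (a' < F l x ∧ F l x < b') := by
    refine hc.box_induction (fun X => ∀ a b, a < b → ∃ a' b', a ≤ a' ∧ a' < b' ∧ b' ≤ b ∧
      ∀ x ∈ X, x ∈ C → (∀ i, i ≠ l → F i x = y i) → ¬ (a' < F l x ∧ F l x < b'))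
      ?_ ?_ ?_ ?_ u v
    · simp only [mem_Icc, Pi.le_def]
      have : ∀ {κ : Type} (G : (κ → K) → (Fin n → K)) [∀ k, DefFn L (fun p => G p k)],
        DefPred L (fun p => G p ∈ C) := fun G _ => hC.comp G
      infer_instance
    · intro X Y hXY h a b hab
      obtain ⟨a', b', h1, h2, h3, h4⟩ := h a b hab
      exact ⟨a', b', h1, h2, h3, fun x hx => h4 x (hXY hx)⟩
    · intro X Y hX hY a b hab
      obtain ⟨a', b', h1, h2, h3, h4⟩ := hX a b hab
      obtain ⟨a₂, b₂, k1, k2, k3, k4⟩ := hY a' b' h2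
      refine ⟨a₂, b₂, h1.trans k1, k2, k3.trans h3, ?_⟩
      rintro x (hx | hx) hxC hxF ⟨hx1, hx2⟩
      · exact h4 x hx hxC hxF ⟨k1.trans_lt hx1, hx2.trans_le k3⟩
      · exact k4 x hx hxC hxF ⟨hx1, hx2⟩
    · intro x
      by_cases hx : x ∈ C ∧ ∀ i, i ≠ l → F i x = y i
      · obtain ⟨δ, hδ, h⟩ := hconst x hx.1
        refine ⟨δ / 2, half_pos hδ, fun a b hab => ?_⟩
        have hz : ∀ z ∈ Icc (fun i => x i - δ / 2) (fun i => x i + δ / 2), z ∈ C →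
            (∀ i, i ≠ l → F i z = y i) → F l z = F l x := by
          intro z hz hzC hzF
          refine h z hzC (fun j => ?_) fun i hi => (hzF i hi).trans (hx.2 i hi).symm
          have := hz.1 j
          have := hz.2 j
          rw [abs_lt]
          constructor <;> linarith
        rcases le_or_gt (F l x) ((a + b) / 2) with hle | hlt
        · refine ⟨(a + b) / 2, b, by linarith, by linarith, le_rfl, fun z h1 h2 h3 h4 => ?_⟩
          rw [hz z h1 h2 h3] at h4
          linarith [h4.1]
        · refine ⟨a, (a + b) / 2, le_rfl, by linarith, by linarith, fun z h1 h2 h3 h4 => ?_⟩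
          rw [hz z h1 h2 h3] at h4
          linarith [h4.2]
      · rw [not_and_or] at hx
        obtain ⟨δ, hδ, h⟩ : ∃ δ > 0, ∀ z, (∀ i, |z i - x i| < δ) → z ∈ C →
            (∀ i, i ≠ l → F i z = y i) → False := by
          by_cases hxC : x ∈ C
          · have hne : ∃ i, i ≠ l ∧ F i x ≠ y i := by
              by_contra! hcon
              exact hx.elim (· hxC) (· hcon)
            obtain ⟨i, hil, hi⟩ := hne
            have hpos : 0 < |F i x - y i| := abs_pos.2 (sub_ne_zero.2 hi)
            obtain ⟨δ, hδ, h⟩ := continuousWithinAt_iff_abs.1 (hcont i x hxC) _ hpos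
            refine ⟨δ, hδ, fun z hz hzC hzF => ?_⟩
            have := h z hzC hz
            rw [hzF i hil, abs_sub_comm] at this
            exact lt_irrefl _ this
          · obtain ⟨δ, hδ, h⟩ := mem_nhds_iff_abs.1 (hclosed.isOpen_compl.mem_nhds hxC)
            exact ⟨δ, hδ, fun z hz hzC _ => h z hz hzC⟩
        refine ⟨δ / 2, half_pos hδ, fun a b hab => ⟨a, b, le_rfl, hab, le_rfl,
          fun z hz hzC hzF => (h z (fun j => ?_) hzC hzF).elim⟩⟩
        have := hz.1 j
        have := hz.2 j
        rw [abs_lt]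
        constructor <;> linarith
  -- The image contains a box around `y`, hence also the point whose `l`-th coordinate is the
  -- midpoint of a missed interval: a contradiction.
  obtain ⟨a, b, h1, h2, h3, h4⟩ := key (y l - ε) (y l + ε) (by linarith)
  obtain ⟨x, hxC, hx⟩ := hbox (Function.update y l ((a + b) / 2)) (by
    intro i
    by_cases hi : i = l
    · subst hi
      rw [Function.update_self, abs_lt]
      constructor <;> linarith
    · simpa [hi] using hε)
  refine h4 x (hCuv hxC) hxC (fun i hi => ?_) ?_
  · have := congrFun hx i
    simpa [hi] using this
  · have : F l x = (a + b) / 2 := by simpa using congrFun hx l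
    rw [this]
    constructor <;> linarith

end Complete

/-! ### Strict differentiability and the chain rule. -/

section Strict

variable {K : Type w} [Field K] [LinearOrder K] [IsStrictOrderedRing K] {n m : ℕ}

theorem exists_pos_forall_of_finite {α : Type*} [Finite α] {P : α → K → Prop}
    (hP : ∀ a δ δ', δ' ≤ δ → P a δ → P a δ') (h : ∀ a, ∃ δ > 0, P a δ) :
    ∃ δ > 0, ∀ a, P a δ := by
  choose d hd hdP using h
  rcases isEmpty_or_nonempty α with he | hne
  · exact ⟨1, one_pos, fun i => he.elim i⟩
  · obtain ⟨i, hi⟩ := Finite.exists_min d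
    exact ⟨d i, hd i, fun a => hP a _ _ (hi a) (hdP a)⟩

/-- On the open cube of radius `δ` around `x`, increments of `g` differ from those of the linear
form `D` by at most `ε` times the size of the increment of the argument. -/
def ApproxLinear (g : (Fin n → K) → K) (D x : Fin n → K) (δ ε : K) : Prop :=
  ∀ y z, (∀ i, |y i - x i| < δ) → (∀ i, |z i - x i| < δ) → ∀ η, 0 ≤ η →
    (∀ i, |y i - z i| ≤ η) → |g y - g z - ∑ i, D i * (y i - z i)| ≤ ε * η

/-- `g` is strictly differentiable at `x`, with differential `D`. -/
def StrictDiffAt (g : (Fin n → K) → K) (D x : Fin n → K) : Prop :=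
  ∀ ε > 0, ∃ δ > 0, ApproxLinear g D x δ ε

theorem ApproxLinear.mono {g : (Fin n → K) → K} {D x : Fin n → K} {δ δ' ε : K}
    (h : ApproxLinear g D x δ ε) (hδ : δ' ≤ δ) : ApproxLinear g D x δ' ε :=
  fun y z hy hz => h y z (fun i => (hy i).trans_le hδ) fun i => (hz i).trans_le hδ

theorem abs_sum_mul_le (D w : Fin n → K) (η : K) (hw : ∀ i, |w i| ≤ η) :
    |∑ i, D i * w i| ≤ (∑ i, |D i|) * η := by
  rw [Finset.sum_mul]
  refine (Finset.abs_sum_le_sum_abs _ _).trans (Finset.sum_le_sum fun i _ => ?_)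
  rw [abs_mul]
  exact mul_le_mul_of_nonneg_left (hw i) (abs_nonneg _)

theorem ApproxLinear.lipschitz {g : (Fin n → K) → K} {D x : Fin n → K} {δ ε : K}
    (h : ApproxLinear g D x δ ε) {y z : Fin n → K} (hy : ∀ i, |y i - x i| < δ)
    (hz : ∀ i, |z i - x i| < δ) {η : K} (hη : 0 ≤ η) (hyz : ∀ i, |y i - z i| ≤ η) :
    |g y - g z| ≤ (∑ i, |D i| + ε) * η := by
  have h1 := h y z hy hz η hη hyz
  have h2 := abs_sum_mul_le D (fun i => y i - z i) η hyz
  calc |g y - g z| = |(∑ i, D i * (y i - z i)) + (g y - g z - ∑ i, D i * (y i - z i))| := by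
        ring_nf
    _ ≤ _ := abs_add_le _ _
    _ ≤ _ := add_le_add h2 h1
    _ = _ := by ring

theorem ApproxLinear.update {g : (Fin n → K) → K} {D x : Fin n → K} {δ ε : K}
    (h : ApproxLinear g D x δ ε) {w : Fin n → K} (hw : ∀ i, |w i - x i| < δ) {i : Fin n}
    {s t : K} (hs : |s - x i| < δ) (ht : |t - x i| < δ) :
    |g (Function.update w i s) - g (Function.update w i t) - D i * (s - t)| ≤ ε * |s - t| := by
  have aux : ∀ r, |r - x i| < δ → ∀ j, |Function.update w i r j - x j| < δ := by
    intro r hr j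
    by_cases hj : j = i
    · subst hj; simpa using hr
    · simpa [hj] using hw j
  have h1 := h _ _ (aux s hs) (aux t ht) |s - t| (abs_nonneg _) (by
    intro j
    by_cases hj : j = i
    · subst hj; simp
    · simp [hj])
  rw [Finset.sum_eq_single i] at h1
  · simpa using h1
  · intro j _ hj
    simp [hj]
  · simp

/-- Both linear approximations are tested on one short increment in the direction `i`. This supplies
the continuity of the differential at a point of strict differentiability. -/
theorem ApproxLinear.abs_sub_le {g : (Fin n → K) → K} {D D' x y : Fin n → K} {δ ε : K}
    (h : ApproxLinear g D x δ ε) (hy : ∀ i, |y i - x i| < δ) (hg : StrictDiffAt g D' y)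
    (i : Fin n) : |D' i - D i| ≤ ε := by
  refine le_of_forall_pos_le_add fun ε' hε' => ?_
  obtain ⟨δ', hδ', h'⟩ := hg ε' hε'
  have hpos : 0 < δ - |y i - x i| := sub_pos.2 (hy i)
  set t := min (δ' / 2) ((δ - |y i - x i|) / 2) with ht
  have ht0 : 0 < t := lt_min (half_pos hδ') (half_pos hpos)
  have e1 := h.update hy (i := i) (s := y i + t) (t := y i) (by
    calc |y i + t - x i| = |(y i - x i) + t| := by ring_nf
      _ ≤ _ := abs_add_le _ _
      _ < δ := by
        rw [abs_of_pos ht0]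
        have := min_le_right (δ' / 2) ((δ - |y i - x i|) / 2)
        linarith) (hy i)
  have e2 := h'.update (w := y) (by simp [hδ']) (i := i) (s := y i + t) (t := y i) (by
    rw [add_sub_cancel_left, abs_of_pos ht0]
    have := min_le_left (δ' / 2) ((δ - |y i - x i|) / 2)
    linarith) (by simpa using hδ')
  rw [add_sub_cancel_left, abs_of_pos ht0] at e1 e2
  have e3 : |(D' i - D i) * t| ≤ (ε + ε') * t := by
    set A := g (Function.update y i (y i + t)) - g (Function.update y i (y i))
    calc |(D' i - D i) * t| = |(A - D i * t) - (A - D' i * t)| := by ring_nf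
      _ ≤ _ := abs_sub _ _
      _ ≤ _ := add_le_add e1 e2
      _ = _ := by ring
  rw [abs_mul, abs_of_pos ht0] at e3
  exact le_of_mul_le_mul_right e3 ht0

theorem StrictDiffAt.sub_const {g : (Fin n → K) → K} {D x : Fin n → K} (h : StrictDiffAt g D x)
    (c : K) : StrictDiffAt (fun y => g y - c) D x := by
  intro ε hε
  obtain ⟨δ, hδ, h⟩ := h ε hε
  refine ⟨δ, hδ, fun y z hy hz η hη hyz => ?_⟩
  simpa using h y z hy hz η hη hyz

theorem StrictDiffAt.proj (k : Fin n) (x : Fin n → K) :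
    StrictDiffAt (fun y => y k) (Pi.single k 1) x := by
  intro ε hε
  refine ⟨1, one_pos, fun y z _ _ η hη _ => ?_⟩
  rw [Finset.sum_eq_single k]
  · simpa using mul_nonneg hε.le hη
  · intro j _ hj
    simp [hj]
  · simp

theorem StrictDiffAt.lipschitz {g : (Fin n → K) → K} {D x : Fin n → K} (h : StrictDiffAt g D x) :
    ∃ δ > 0, ∀ y z, (∀ i, |y i - x i| < δ) → (∀ i, |z i - x i| < δ) → ∀ η, 0 ≤ η →
      (∀ i, |y i - z i| ≤ η) → |g y - g z| ≤ (∑ i, |D i| + 1) * η := by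
  obtain ⟨δ, hδ, h⟩ := h 1 one_pos
  exact ⟨δ, hδ, fun y z hy hz η hη hyz => h.lipschitz hy hz hη hyz⟩

theorem StrictDiffAt.continuousAt {g : (Fin n → K) → K} {D x : Fin n → K}
    (h : StrictDiffAt g D x) {ε : K} (hε : 0 < ε) :
    ∃ δ > 0, ∀ y, (∀ i, |y i - x i| < δ) → |g y - g x| < ε := by
  obtain ⟨δ, hδ, h⟩ := h.lipschitz
  set C := ∑ i, |D i| + 1 with hC
  have hC0 : 0 < C := add_pos_of_nonneg_of_pos (Finset.sum_nonneg fun i _ => abs_nonneg _) one_pos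
  refine ⟨min δ (ε / (2 * C)), lt_min hδ (by positivity), fun y hy => ?_⟩
  have h1 := h y x (fun i => (hy i).trans_le (min_le_left _ _)) (by simp [hδ])
    (ε / (2 * C)) (by positivity) (fun i => ((hy i).trans_le (min_le_right _ _)).le)
  have h2 : C * (ε / (2 * C)) = ε / 2 := by field_simp
  linarith

theorem StrictDiffAt.comp {g : (Fin m → K) → K} {D : Fin m → K}
    {φ : (Fin n → K) → Fin m → K} {A : Fin m → Fin n → K} {x : Fin n → K}
    (hg : StrictDiffAt g D (φ x)) (hφ : ∀ k, StrictDiffAt (fun y => φ y k) (A k) x) :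
    StrictDiffAt (fun y => g (φ y)) (fun i => ∑ k, D k * A k i) x := by
  intro ε hε
  obtain ⟨C, hC0, hC⟩ : ∃ C : K, 0 < C ∧ ∀ k, ∑ i, |A k i| + 1 ≤ C := by
    refine ⟨∑ k, (∑ i, |A k i| + 1) + 1, ?_, fun k => ?_⟩
    · refine add_pos_of_nonneg_of_pos (Finset.sum_nonneg fun k _ => ?_) one_pos
      exact add_nonneg (Finset.sum_nonneg fun i _ => abs_nonneg _) zero_le_one
    · have := Finset.single_le_sum (f := fun k => ∑ i, |A k i| + 1)
        (fun k _ => add_nonneg (Finset.sum_nonneg fun i _ => abs_nonneg (A k i)) zero_le_one)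
        (Finset.mem_univ k)
      linarith
  -- Each source of error gets half of `ε`: that of `g` is magnified by the Lipschitz constant `C`
  -- of `φ`, those of the components of `φ` are weighted by the `|D k|`, of sum at most `S`.
  obtain ⟨δ₁, hδ₁, h₁⟩ := hg (ε / (2 * C)) (by positivity)
  set S := ∑ k, |D k| + 1 with hS
  have hS0 : 0 < S := add_pos_of_nonneg_of_pos (Finset.sum_nonneg fun i _ => abs_nonneg _) one_pos
  obtain ⟨δ₂, hδ₂, h₂⟩ := exists_pos_forall_of_finite
    (P := fun k δ => ApproxLinear (fun y => φ y k) (A k) x δ (ε / (2 * S)))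
    (fun k δ δ' hd h => h.mono hd) (fun k => hφ k (ε / (2 * S)) (by positivity))
  obtain ⟨δ₃, hδ₃, h₃⟩ := exists_pos_forall_of_finite
    (P := fun k δ => ∀ y z : Fin n → K, (∀ i, |y i - x i| < δ) → (∀ i, |z i - x i| < δ) → ∀ η, 0 ≤ η →
      (∀ i, |y i - z i| ≤ η) → |φ y k - φ z k| ≤ (∑ i, |A k i| + 1) * η)
    (fun k δ δ' hd h y z hy hz => h y z (fun i => (hy i).trans_le hd)
      (fun i => (hz i).trans_le hd)) (fun k => (hφ k).lipschitz)
  have hlip : ∀ y z, (∀ i, |y i - x i| < δ₃) → (∀ i, |z i - x i| < δ₃) → ∀ η, 0 ≤ η →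
      (∀ i, |y i - z i| ≤ η) → ∀ k, |φ y k - φ z k| ≤ C * η :=
    fun y z hy hz η hη hyz k =>
      (h₃ k y z hy hz η hη hyz).trans (mul_le_mul_of_nonneg_right (hC k) hη)
  refine ⟨min (min δ₂ δ₃) (δ₁ / (2 * C)), by positivity, fun y z hy hz η hη hyz => ?_⟩
  have near : ∀ y, (∀ i, |y i - x i| < min (min δ₂ δ₃) (δ₁ / (2 * C))) →
      ∀ k, |φ y k - φ x k| < δ₁ := by
    intro y hy k
    have := hlip y x (fun i => (hy i).trans_le ((min_le_left _ _).trans (min_le_right _ _)))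
      (by simp [hδ₃]) (δ₁ / (2 * C)) (by positivity)
      (fun i => ((hy i).trans_le (min_le_right _ _)).le) k
    have e : C * (δ₁ / (2 * C)) = δ₁ / 2 := by field_simp
    linarith
  have l2 : min (min δ₂ δ₃) (δ₁ / (2 * C)) ≤ δ₂ := (min_le_left _ _).trans (min_le_left _ _)
  have l3 : min (min δ₂ δ₃) (δ₁ / (2 * C)) ≤ δ₃ := (min_le_left _ _).trans (min_le_right _ _)
  have e1 := h₁ (φ y) (φ z) (near y hy) (near z hz) (C * η) (by positivity)
    (hlip y z (fun i => (hy i).trans_le l3) (fun i => (hz i).trans_le l3) η hη hyz)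
  have e2 := abs_sum_mul_le D (fun k => φ y k - φ z k - ∑ i, A k i * (y i - z i))
    (ε / (2 * S) * η) (fun k => h₂ k y z (fun i => (hy i).trans_le l2)
      (fun i => (hz i).trans_le l2) η hη hyz)
  have e3 : ∑ i, (∑ k, D k * A k i) * (y i - z i) =
      ∑ k, D k * (φ y k - φ z k) -
        ∑ k, D k * (φ y k - φ z k - ∑ i, A k i * (y i - z i)) := by
    rw [← Finset.sum_sub_distrib]
    simp only [Finset.sum_mul]
    rw [Finset.sum_comm]
    refine Finset.sum_congr rfl fun k _ => ?_
    rw [← mul_sub, sub_sub_cancel, Finset.mul_sum]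
    exact Finset.sum_congr rfl fun i _ => by ring
  rw [e3]
  have e4 : ε / (2 * C) * (C * η) = ε / 2 * η := by field_simp
  have e5 : (∑ k, |D k|) * (ε / (2 * S) * η) ≤ ε / 2 * η := by
    have : (∑ k, |D k|) ≤ S := by linarith
    calc (∑ k, |D k|) * (ε / (2 * S) * η) ≤ S * (ε / (2 * S) * η) :=
          mul_le_mul_of_nonneg_right this (by positivity)
      _ = _ := by field_simp
  calc _ = |(g (φ y) - g (φ z) - ∑ k, D k * (φ y k - φ z k)) +
        ∑ k, D k * (φ y k - φ z k - ∑ i, A k i * (y i - z i))| := by ring_nf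
    _ ≤ _ := abs_add_le _ _
    _ ≤ ε / 2 * η + ε / 2 * η := add_le_add (e1.trans e4.le) (e2.trans e5)
    _ = ε * η := by ring

end Strict

/-! ### Strict differentiability from continuous partial derivatives. -/

section Complete

variable {L : FirstOrder.Language.{u, v}} {K : Type w} [L.Structure K]
  [Field K] [LinearOrder K] [IsStrictOrderedRing K]
  [hK : Fact (ExpandsOrderedField L K)] {n m : ℕ}

/-- A definable function with continuous partial derivatives is strictly differentiable. -/
theorem DefinablyComplete.strictDiffAt (hc : DefinablyComplete L K) (g : (Fin n → K) → K)
    [hg : DefFn L g] (D : (Fin n → K) → Fin n → K) (x : Fin n → K) {ρ : K} (hρ : 0 < ρ)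
    (hD : ∀ y, (∀ i, |y i - x i| < ρ) → ∀ i, ∀ ε > 0, ∃ δ > 0, ∀ t, |t - y i| < δ →
      |g (Function.update y i t) - g y - D y i * (t - y i)| ≤ ε * |t - y i|)
    (hcont : ∀ i, ∀ ε > 0, ∃ δ > 0, ∀ y, (∀ i, |y i - x i| < δ) → |D y i - D x i| ≤ ε) :
    StrictDiffAt g (D x) x := by
  intro ε hε
  set ε' := ε / (n + 1) with hε'
  have hε0 : 0 < ε' := by positivity
  obtain ⟨δ₁, hδ₁, h₁⟩ := exists_pos_forall_of_finite
    (P := fun i δ => ∀ y : Fin n → K, (∀ i, |y i - x i| < δ) → |D y i - D x i| ≤ ε')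
    (fun k δ δ' hd h y hy => h y fun i => (hy i).trans_le hd) (fun k => hcont k ε' hε0)
  refine ⟨min ρ δ₁, lt_min hρ hδ₁, fun y z hy hz η hη hyz => ?_⟩
  -- Mean value inequality along one coordinate, for `g` minus its linear part at `x`, whose slopes
  -- there are at most `ε'`.
  have one : ∀ w a, (∀ i, |w i - x i| < min ρ δ₁) → ∀ c d, c ≤ d → |c - x a| < min ρ δ₁ →
      |d - x a| < min ρ δ₁ → |g (Function.update w a d) - g (Function.update w a c) -
        D x a * (d - c)| ≤ ε' * (d - c) := by
    intro w a hw c d hcd hca hda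
    have hf : DefFn L (fun p : Unit → K => g (Function.update w a (p ())) - D x a * p ()) := by
      have : DefFn L (fun p : Unit → K => g (Function.update w a (p ()))) := by
        have : ∀ k, DefFn L (fun p : Unit → K => Function.update w a (p ()) k) :=
          fun k => DefFn.update (fun _ => w) a k (fun p => p ())
        infer_instance
      infer_instance
    have := hc.mean_value_inequality (fun t => g (Function.update w a t) - D x a * t) hf hcd ε' (by
      intro t hct htd e he
      have hta : |t - x a| < min ρ δ₁ := by
        rw [abs_lt] at hca hda ⊢
        constructor <;> linarith [hca.1, hda.2]
      have hu : ∀ i, |Function.update w a t i - x i| < min ρ δ₁ := by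
        intro j
        by_cases hj : j = a
        · subst hj; simpa using hta
        · simpa [hj] using hw j
      obtain ⟨δ, hδ, h⟩ := hD (Function.update w a t)
        (fun i => (hu i).trans_le (min_le_left _ _)) a e he
      refine ⟨δ, hδ, fun s _ _ hs => ?_⟩
      have e1 := h s (by simpa using hs)
      rw [Function.update_idem, Function.update_self] at e1
      have e2 := h₁ a (Function.update w a t) (fun i => (hu i).trans_le (min_le_right _ _))
      calc _ = |(g (Function.update w a s) - g (Function.update w a t) -
            D (Function.update w a t) a * (s - t)) +
            (D (Function.update w a t) a - D x a) * (s - t)| := by ring_nf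
        _ ≤ _ := abs_add_le _ _
        _ ≤ e * |s - t| + ε' * |s - t| := by
          refine add_le_add e1 ?_
          rw [abs_mul]
          exact mul_le_mul_of_nonneg_right e2 (abs_nonneg _)
        _ = _ := by ring)
    calc _ = |g (Function.update w a d) - D x a * d - (g (Function.update w a c) - D x a * c)| := by
          ring_nf
      _ ≤ _ := this
  have two : ∀ w a, (∀ i, |w i - x i| < min ρ δ₁) → ∀ c d, |c - x a| < min ρ δ₁ →
      |d - x a| < min ρ δ₁ → |g (Function.update w a d) - g (Function.update w a c) -
        D x a * (d - c)| ≤ ε' * |d - c| := by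
    intro w a hw c d hca hda
    rcases le_total c d with h | h
    · rw [abs_of_nonneg (sub_nonneg.2 h)]
      exact one w a hw c d h hca hda
    · have := one w a hw d c h hda hca
      rw [abs_sub_comm d c, abs_of_nonneg (sub_nonneg.2 h), ← abs_neg]
      convert this using 2
      ring
  -- The coordinates of `z` are replaced by those of `y` one at a time, at a cost of `ε' * η` each.
  have claim : ∀ s : Finset (Fin n), |g (fun i => if i ∈ s then y i else z i) - g z -
      ∑ i ∈ s, D x i * (y i - z i)| ≤ s.card * (ε' * η) := by
    intro s
    induction s using Finset.induction_on with
    | empty => simp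
    | insert a s has ih =>
      set w : Fin n → K := fun i => if i ∈ s then y i else z i with hw
      have hwx : ∀ i, |w i - x i| < min ρ δ₁ := by
        intro i
        rw [hw]
        dsimp only
        split_ifs
        exacts [hy i, hz i]
      have e := two w a hwx (z a) (y a) (hz a) (hy a)
      have w1 : Function.update w a (z a) = w := by
        rw [Function.update_eq_self_iff, hw]
        simp [has]
      have w2 : (fun i => if i ∈ insert a s then y i else z i) = Function.update w a (y a) := by
        ext i
        by_cases hi : i = a
        · subst hi; simp
        · simp [hi, hw]
      rw [w1] at e
      rw [w2, Finset.sum_insert has, Finset.card_insert_of_notMem has]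
      calc _ = |(g (Function.update w a (y a)) - g w - D x a * (y a - z a)) +
            (g w - g z - ∑ i ∈ s, D x i * (y i - z i))| := by ring_nf
        _ ≤ _ := abs_add_le _ _
        _ ≤ ε' * η + s.card * (ε' * η) :=
          add_le_add (e.trans (mul_le_mul_of_nonneg_left (hyz a) hε0.le)) ih
        _ = _ := by push_cast; ring
  have := claim Finset.univ
  simp only [Finset.mem_univ, if_true, Finset.card_univ, Fintype.card_fin] at this
  refine this.trans ?_
  have : (n : K) * ε' ≤ ε := by
    rw [hε', mul_div_assoc', div_le_iff₀ (by positivity)]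
    nlinarith
  calc (n : K) * (ε' * η) = n * ε' * η := by ring
    _ ≤ _ := mul_le_mul_of_nonneg_right this hη

end Complete

/-! ### Definable implicit functions. -/

section Complete

variable {L : FirstOrder.Language.{u, v}} {K : Type w} [L.Structure K]
  [Field K] [LinearOrder K] [IsStrictOrderedRing K]
  [hK : Fact (ExpandsOrderedField L K)] {n m : ℕ}

theorem DefFn.comp_update (f : (Fin n → K) → K) [DefFn L f] {ι : Type}
    (x : (ι → K) → Fin n → K) (i : Fin n) (t : (ι → K) → K)
    [∀ k, DefFn L (fun p => x p k)] [DefFn L t] :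
    DefFn L (fun p => f (Function.update (x p) i (t p))) :=
  have : ∀ k, DefFn L (fun p => Function.update (x p) i (t p) k) := fun k => DefFn.update x i k t
  DefFn.comp f _

/-- The function choosing the unique solution `t` of a definable condition `R x t`, and equal to
`c` where there is no solution, is definable. -/
theorem exists_defFn_of_unique {ι : Type} (R : (ι → K) → K → Prop) (c : K)
    (hR : DefPred L (fun q : ι ⊕ Unit → K => R (fun i => q (Sum.inl i)) (q (Sum.inr ()))))
    (huniq : ∀ x s t, R x s → R x t → s = t) :
    ∃ f : (ι → K) → K, DefFn L f ∧ ∀ x t, R x t → f x = t := by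
  classical
  let f : (ι → K) → K := fun x => if h : ∃ t, R x t then h.choose else c
  have hf : ∀ x t, R x t → f x = t := by
    intro x t h
    have hex : ∃ t, R x t := ⟨t, h⟩
    simp only [f, dif_pos hex]
    exact huniq x _ _ hex.choose_spec h
  refine ⟨f, DefFn.of_graph f ?_, hf⟩
  have hgraph : ∀ x t, f x = t ↔ R x t ∨ ((∀ s, ¬ R x s) ∧ t = c) := by
    intro x t
    by_cases hex : ∃ t, R x t
    · obtain ⟨s, hs⟩ := hex
      rw [hf x s hs]
      constructor
      · rintro rfl; exact Or.inl hs
      · rintro (h | ⟨h, -⟩)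
        exacts [huniq x _ _ hs h, absurd hs (h s)]
    · have : f x = c := dif_neg hex
      rw [this]
      push Not at hex
      constructor
      · rintro rfl; exact Or.inr ⟨hex, rfl⟩
      · rintro (h | ⟨-, h⟩)
        exacts [absurd h (hex t), h.symm]
  simp only [hgraph]
  have : DefPred L (fun q : (ι ⊕ Unit) ⊕ Unit → K =>
      R (fun i => q (Sum.inl (Sum.inl i))) (q (Sum.inr ()))) := by
    refine ⟨hR.out.preimage_comp (fun s : ι ⊕ Unit =>
      (Sum.elim (fun i => Sum.inl (Sum.inl i)) Sum.inr s : (ι ⊕ Unit) ⊕ Unit))⟩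
  infer_instance

/-- A Lipschitz function defined implicitly by `G y = 0` is strictly differentiable. -/
theorem strictDiffAt_of_implicit {G ξ : (Fin n → K) → K} {x D : Fin n → K} {i : Fin n}
    (hG : StrictDiffAt G D (Function.update x i (ξ x))) (hi : D i ≠ 0) {τ C : K} (hτ : 0 < τ)
    (hzero : ∀ y, (∀ j, |y j - x j| < τ) → G (Function.update y i (ξ y)) = 0) (hC : 1 ≤ C)
    (hlip : ∀ y z, (∀ j, |y j - x j| < τ) → (∀ j, |z j - x j| < τ) → ∀ η, 0 ≤ η →
      (∀ j, |y j - z j| ≤ η) → |ξ y - ξ z| ≤ C * η) :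
    StrictDiffAt ξ (fun j => if j = i then 0 else - (D j / D i)) x := by
  intro ε hε
  have hC0 : 0 < C := zero_lt_one.trans_le hC
  have hb0 : 0 < |D i| := abs_pos.2 hi
  -- An increment `η` of the argument becomes at most `C * η` on the graph (`1 ≤ C` covers the
  -- unchanged coordinates), and solving for `ξ` divides by `D i`.
  obtain ⟨δ, hδ, h⟩ := hG (ε * |D i| / C) (by positivity)
  have hφlip : ∀ y z, (∀ j, |y j - x j| < τ) → (∀ j, |z j - x j| < τ) → ∀ η, 0 ≤ η →
      (∀ j, |y j - z j| ≤ η) → ∀ j, |Function.update y i (ξ y) j -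
        Function.update z i (ξ z) j| ≤ C * η := by
    intro y z hy hz η hη hyz j
    by_cases hj : j = i
    · subst hj
      simpa using hlip y z hy hz η hη hyz
    · have : η ≤ C * η := le_mul_of_one_le_left hη hC
      simpa [hj] using (hyz j).trans this
  have hxτ : ∀ j, |x j - x j| < τ := fun j => by simpa using hτ
  have hnear : ∀ y, (∀ j, |y j - x j| < min τ (δ / (2 * C))) →
      ∀ j, |Function.update y i (ξ y) j - Function.update x i (ξ x) j| < δ := by
    intro y hy j
    have := hφlip y x (fun j => (hy j).trans_le (min_le_left _ _)) hxτ (δ / (2 * C))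
      (by positivity) (fun j => ((hy j).trans_le (min_le_right _ _)).le) j
    have e : C * (δ / (2 * C)) = δ / 2 := by field_simp
    linarith
  refine ⟨min τ (δ / (2 * C)), by positivity, fun y z hy hz η hη hyz => ?_⟩
  have hyτ : ∀ j, |y j - x j| < τ := fun j => (hy j).trans_le (min_le_left _ _)
  have hzτ : ∀ j, |z j - x j| < τ := fun j => (hz j).trans_le (min_le_left _ _)
  have e1 := h _ _ (hnear y hy) (hnear z hz) (C * η) (by positivity) (hφlip y z hyτ hzτ η hη hyz)
  rw [hzero y hyτ, hzero z hzτ, sub_zero, zero_sub, abs_neg] at e1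
  have e2 : ε * |D i| / C * (C * η) = ε * η * |D i| := by field_simp
  have e3 : ∑ j, D j * (Function.update y i (ξ y) j - Function.update z i (ξ z) j) =
      (ξ y - ξ z - ∑ j, (if j = i then 0 else - (D j / D i)) * (y j - z j)) * D i := by
    rw [sub_mul, Finset.sum_mul, sub_eq_add_neg, ← Finset.sum_neg_distrib,
      ← Finset.add_sum_erase _ _ (Finset.mem_univ i),
      ← Finset.add_sum_erase (a := i) (f := fun j => -((if j = i then 0 else
        - (D j / D i)) * (y j - z j) * D i)) _ (Finset.mem_univ i)]
    simp only [Function.update_self, if_true, zero_mul, neg_zero, zero_add]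
    congr 1
    · ring
    refine Finset.sum_congr rfl fun j hj => ?_
    have hji : j ≠ i := Finset.ne_of_mem_erase hj
    rw [if_neg hji, Function.update_of_ne hji, Function.update_of_ne hji]
    field_simp
  rw [e2, e3, abs_mul] at e1
  exact le_of_mul_le_mul_right e1 hb0

set_option maxHeartbeats 800000 in
/-- The implicit function theorem for one equation, solved for the coordinate `i`. -/
theorem DefinablyComplete.implicit_function (hc : DefinablyComplete L K) (G : (Fin n → K) → K)
    [hG : DefFn L G] (D : (Fin n → K) → Fin n → K) (x₀ : Fin n → K) (i : Fin n) {ρ : K}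
    (hρ : 0 < ρ) (hD : ∀ x, (∀ j, |x j - x₀ j| < ρ) → StrictDiffAt G (D x) x)
    (hi : D x₀ i ≠ 0) (h0 : G x₀ = 0) :
    ∃ ξ : (Fin n → K) → K, DefFn L ξ ∧ ξ x₀ = x₀ i ∧ ∃ σ > 0, ∃ B, σ ≤ ρ ∧ 0 ≤ B ∧
      ∀ x, (∀ j, |x j - x₀ j| < σ) →
        (∀ j, |Function.update x i (ξ x) j - x₀ j| < ρ) ∧ G (Function.update x i (ξ x)) = 0 ∧
        (G x = 0 → ξ x = x i) ∧ D (Function.update x i (ξ x)) i ≠ 0 ∧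
        StrictDiffAt ξ (fun j => if j = i then 0 else
          - (D (Function.update x i (ξ x)) j / D (Function.update x i (ξ x)) i)) x ∧
        ∀ j, |D (Function.update x i (ξ x)) j / D (Function.update x i (ξ x)) i| ≤ B := by
  set a := D x₀ i with ha
  have ha0 : 0 < |a| := abs_pos.2 hi
  -- With error `|a| / 2`, the slopes of `G` in the coordinate `i` differ from `a` by at most half
  -- of it. This gives uniqueness of the root, the change of sign and the Lipschitz bound.
  obtain ⟨δ, hδ, hδρ, hlin⟩ : ∃ δ > 0, δ ≤ ρ ∧ ApproxLinear G (D x₀) x₀ δ (|a| / 2) := by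
    obtain ⟨δ, hδ, h⟩ := hD x₀ (by simpa using fun _ => hρ) (|a| / 2) (half_pos ha0)
    exact ⟨min δ ρ, lt_min hδ hρ, min_le_right _ _, h.mono (min_le_left _ _)⟩
  set S := ∑ j, |D x₀ j| with hS
  have hS0 : 0 ≤ S := Finset.sum_nonneg fun j _ => abs_nonneg _
  set R : (Fin n → K) → K → Prop := fun x t =>
    (∀ j, |x j - x₀ j| < δ) ∧ |t - x₀ i| < δ ∧ G (Function.update x i t) = 0 with hR
  have huniq : ∀ x s t, R x s → R x t → s = t := by
    rintro x s t ⟨hx, hs, hGs⟩ ⟨-, ht, hGt⟩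
    have := hlin.update hx hs ht
    rw [hGs, hGt, sub_self, zero_sub, abs_neg, abs_mul] at this
    by_contra hne
    have h1 : 0 < |s - t| := abs_pos.2 (sub_ne_zero.2 hne)
    have h2 := le_of_mul_le_mul_right this h1
    rw [← ha] at h2
    linarith
  obtain ⟨ξ, hξ, hξR⟩ := exists_defFn_of_unique (L := L) R 0 (by
    have : DefFn L (fun q : Fin n ⊕ Unit → K =>
        G (Function.update (fun j => q (Sum.inl j)) i (q (Sum.inr ())))) :=
      DefFn.comp_update G (fun q : Fin n ⊕ Unit → K => fun j => q (Sum.inl j)) i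
        (fun q => q (Sum.inr ()))
    infer_instance) huniq
  set C := S + |a| / 2 with hC
  have hC0 : 0 < C := by positivity
  -- Over `x₀`, `|G|` is at least `|a| * δ / 4` when the coordinate `i` is moved by `±δ / 2`; moving
  -- the base point by `σ` changes `G` by less than that.
  obtain ⟨σ, hσ, hσδ, hσ2⟩ : ∃ σ > 0, σ ≤ δ ∧ C * σ < |a| * δ / 4 := by
    refine ⟨min δ (|a| * δ / (8 * C)), by positivity, min_le_left _ _, ?_⟩
    calc C * _ ≤ C * (|a| * δ / (8 * C)) := mul_le_mul_of_nonneg_left (min_le_right _ _) hC0.le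
      _ = |a| * δ / 8 := by field_simp
      _ < _ := by linarith [mul_pos ha0 hδ]
  have hupd : ∀ x, (∀ j, |x j - x₀ j| < δ) → ∀ t, |t - x₀ i| < δ →
      ∀ j, |Function.update x i t j - x₀ j| < δ := by
    intro x hx t ht j
    by_cases hj : j = i
    · subst hj; simpa using ht
    · simpa [hj] using hx j
  have hx₀ : ∀ j, |x₀ j - x₀ j| < δ := fun j => by simpa using hδ
  have hex : ∀ x, (∀ j, |x j - x₀ j| < σ) → R x (ξ x) := by
    intro x hx
    have hxδ : ∀ j, |x j - x₀ j| < δ := fun j => (hx j).trans_le hσδ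
    -- The factor `a` makes the sign change from negative to positive, whatever the sign of `a`.
    suffices h : ∃ t, x₀ i - δ / 2 ≤ t ∧ t ≤ x₀ i + δ / 2 ∧ a * G (Function.update x i t) = 0 by
      obtain ⟨t, h1, h2, h3⟩ := h
      have : R x t := ⟨hxδ, by rw [abs_lt]; constructor <;> linarith,
        (mul_eq_zero.1 h3).resolve_left hi⟩
      rwa [hξR x t this]
    have hclose : ∀ t, |t - x₀ i| < δ →
        |a * G (Function.update x i t) - a * G (Function.update x₀ i t)| < a ^ 2 * δ / 4 := by
      intro t ht
      have := hlin.lipschitz (hupd x hxδ t ht) (hupd x₀ hx₀ t ht) hσ.le (by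
        intro j
        by_cases hj : j = i
        · subst hj; simpa using hσ.le
        · simpa [hj] using (hx j).le)
      rw [← mul_sub, abs_mul]
      calc |a| * _ ≤ |a| * (C * σ) := mul_le_mul_of_nonneg_left this ha0.le
        _ < |a| * (|a| * δ / 4) := mul_lt_mul_of_pos_left hσ2 ha0
        _ = a ^ 2 * δ / 4 := by rw [← sq_abs a]; ring
    have hx₀t : ∀ t, |t - x₀ i| < δ →
        |a * G (Function.update x₀ i t) - a ^ 2 * (t - x₀ i)| ≤ a ^ 2 / 2 * |t - x₀ i| := by
      intro t ht
      have := hlin.update hx₀ ht (hx₀ i)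
      rw [Function.update_eq_self, h0, sub_zero, ← ha] at this
      calc _ = |a| * |G (Function.update x₀ i t) - a * (t - x₀ i)| := by
            rw [← abs_mul]; ring_nf
        _ ≤ |a| * (|a| / 2 * |t - x₀ i|) := mul_le_mul_of_nonneg_left this ha0.le
        _ = _ := by rw [← sq_abs a]; ring
    have ha2 : 0 < a ^ 2 := by positivity
    have had : 0 < a ^ 2 * δ := by positivity
    refine hc.intermediate_value (fun t => a * G (Function.update x i t)) ?_ (by linarith) ?_ ?_ ?_
    · have := DefFn.comp_update (L := L) G (fun _ : Unit → K => x) i (fun p => p ())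
      infer_instance
    · intro t h1 h2 ε hε
      refine ⟨ε / (|a| * C), by positivity, fun s h3 h4 hst => ?_⟩
      have := hlin.lipschitz (hupd x hxδ s (by rw [abs_lt]; constructor <;> linarith))
        (hupd x hxδ t (by rw [abs_lt]; constructor <;> linarith)) (abs_nonneg (s - t)) (by
        intro j
        by_cases hj : j = i
        · subst hj; simp
        · simp [hj])
      rw [← mul_sub, abs_mul]
      calc |a| * _ ≤ |a| * (C * |s - t|) := mul_le_mul_of_nonneg_left this ha0.le
        _ = |s - t| * (|a| * C) := by ring
        _ < ε := by rwa [lt_div_iff₀ (by positivity)] at hst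
    · have e : |x₀ i - δ / 2 - x₀ i| = δ / 2 := by
        rw [show x₀ i - δ / 2 - x₀ i = -(δ / 2) by ring, abs_neg, abs_of_pos (half_pos hδ)]
      have h1 := (abs_lt.1 (hclose (x₀ i - δ / 2) (by rw [e]; linarith))).2
      have h2 := (abs_le.1 (hx₀t (x₀ i - δ / 2) (by rw [e]; linarith))).2
      rw [e] at h2
      linarith
    · have e : |x₀ i + δ / 2 - x₀ i| = δ / 2 := by
        rw [show x₀ i + δ / 2 - x₀ i = δ / 2 by ring, abs_of_pos (half_pos hδ)]
      have h1 := (abs_lt.1 (hclose (x₀ i + δ / 2) (by rw [e]; linarith))).1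
      have h2 := (abs_le.1 (hx₀t (x₀ i + δ / 2) (by rw [e]; linarith))).1
      rw [e] at h2
      linarith
  have hφδ : ∀ x, (∀ j, |x j - x₀ j| < σ) → ∀ j, |Function.update x i (ξ x) j - x₀ j| < δ :=
    fun x hx => hupd x (fun j => (hx j).trans_le hσδ) _ (hex x hx).2.1
  have hlip : ∀ y z, (∀ j, |y j - x₀ j| < σ) → (∀ j, |z j - x₀ j| < σ) → ∀ η, 0 ≤ η →
      (∀ j, |y j - z j| ≤ η) → |ξ y - ξ z| ≤ (2 * C / |a| + 1) * η := by
    intro y z hy hz η hη hyz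
    -- The auxiliary point over `z` at the height of `y` separates the change of base point from the
    -- change of height.
    set w := Function.update z i (ξ y) with hw
    have h1 := hlin.lipschitz (hφδ y hy)
      (hupd z (fun j => (hz j).trans_le hσδ) _ (hex y hy).2.1) hη (by
        intro j
        by_cases hj : j = i
        · subst hj; simpa using hη
        · simpa [hj] using hyz j)
    have h2 := hlin.update (fun j => (hz j).trans_le hσδ) (hex y hy).2.1 (hex z hz).2.1
    rw [(hex y hy).2.2, zero_sub, abs_neg] at h1
    rw [(hex z hz).2.2, sub_zero, ← ha] at h2
    have h3 : |a * (ξ y - ξ z)| ≤ C * η + |a| / 2 * |ξ y - ξ z| := by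
      calc |a * (ξ y - ξ z)| = |G w - (G w - a * (ξ y - ξ z))| := by ring_nf
        _ ≤ _ := abs_sub _ _
        _ ≤ _ := add_le_add h1 h2
    rw [abs_mul] at h3
    have h4 : |a| * |ξ y - ξ z| ≤ 2 * C * η := by linarith
    have h5 : |ξ y - ξ z| ≤ 2 * C / |a| * η := by
      rw [div_mul_eq_mul_div, le_div_iff₀ ha0]
      linarith
    linarith
  have hcoef : ∀ x, (∀ j, |x j - x₀ j| < σ) → ∀ j,
      |D (Function.update x i (ξ x)) j - D x₀ j| ≤ |a| / 2 := fun x hx j =>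
    hlin.abs_sub_le (hφδ x hx) (hD _ fun j => (hφδ x hx j).trans_le hδρ) j
  have hb : ∀ x, (∀ j, |x j - x₀ j| < σ) → |a| / 2 ≤ |D (Function.update x i (ξ x)) i| := by
    intro x hx
    have h1 := hcoef x hx i
    rw [abs_sub_comm] at h1
    have h2 := abs_sub_abs_le_abs_sub a (D (Function.update x i (ξ x)) i)
    linarith
  refine ⟨ξ, hξ, hξR _ _ ⟨hx₀, hx₀ i, by rw [Function.update_eq_self, h0]⟩, σ, hσ,
    C / (|a| / 2), hσδ.trans hδρ, by positivity, fun x hx => ?_⟩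
  have hbx := hb x hx
  have hb0 : 0 < |D (Function.update x i (ξ x)) i| := (half_pos ha0).trans_le hbx
  refine ⟨fun j => (hφδ x hx j).trans_le hδρ, (hex x hx).2.2, fun hGx => ?_, abs_pos.1 hb0, ?_, ?_⟩
  · exact hξR _ _ ⟨fun j => (hx j).trans_le hσδ, (hx i).trans_le hσδ,
      by rw [Function.update_eq_self, hGx]⟩
  · obtain ⟨τ, hτ, hτx⟩ : ∃ τ > 0, ∀ y : Fin n → K, (∀ j, |y j - x j| < τ) →
        ∀ j, |y j - x₀ j| < σ := by
      obtain ⟨τ, hτ, h⟩ := exists_pos_forall_of_finite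
        (P := fun j τ => |x j - x₀ j| + τ ≤ σ) (fun j δ δ' hd h => by linarith)
        (fun j => ⟨σ - |x j - x₀ j|, sub_pos.2 (hx j), by linarith⟩)
      refine ⟨τ, hτ, fun y hy j => ?_⟩
      have := abs_add_le (y j - x j) (x j - x₀ j)
      rw [sub_add_sub_cancel] at this
      linarith [h j, hy j]
    refine strictDiffAt_of_implicit (hD _ fun j => (hφδ x hx j).trans_le hδρ) (abs_pos.1 hb0) hτ
      (fun y hy => (hex y (hτx y hy)).2.2) (C := 2 * C / |a| + 1) ?_ ?_
    · have : 0 ≤ 2 * C / |a| := by positivity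
      linarith
    · exact fun y z hy hz => hlip y z (hτx y hy) (hτx z hz)
  · intro j
    rw [abs_div]
    refine div_le_div₀ hC0.le ?_ (half_pos ha0) hbx
    have h1 := hcoef x hx j
    have h2 : |D x₀ j| ≤ S := Finset.single_le_sum (f := fun j => |D x₀ j|)
      (fun j _ => abs_nonneg _) (Finset.mem_univ j)
    have h3 := abs_sub_abs_le_abs_sub (D (Function.update x i (ξ x)) j) (D x₀ j)
    linarith

end Complete

/-! ### A Gronwall argument on level sets. -/

section Complete

variable {L : FirstOrder.Language.{u, v}} {K : Type w} [L.Structure K]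
  [Field K] [LinearOrder K] [IsStrictOrderedRing K]
  [hK : Fact (ExpandsOrderedField L K)] {n q : ℕ}

/-- Functions that vanish at a point and whose differentials are bounded by their values vanish
near that point. -/
theorem DefinablyComplete.eventually_eq_zero (hc : DefinablyComplete L K)
    (h : Fin q → (Fin n → K) → K) (hdef : ∀ a, DefFn L (h a))
    (Dh : Fin q → (Fin n → K) → Fin n → K) (x₀ : Fin n → K) {ρ C : K} (hρ : 0 < ρ) (hC : 0 ≤ C)
    (hh : ∀ a x, (∀ i, |x i - x₀ i| < ρ) → StrictDiffAt (h a) (Dh a x) x)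
    (h0 : ∀ a, h a x₀ = 0)
    (hrel : ∀ x, (∀ i, |x i - x₀ i| < ρ) → ∀ a i M, (∀ b, |h b x| ≤ M) → |Dh a x i| ≤ C * M) :
    ∃ σ > 0, ∀ x, (∀ i, |x i - x₀ i| < σ) → ∀ a, h a x = 0 := by
  obtain ⟨σ₀, hσ₀, hb⟩ := exists_pos_forall_of_finite
    (P := fun a δ => ∀ x : Fin n → K, (∀ i, |x i - x₀ i| < δ) → |h a x| < 1)
    (fun a δ δ' hd H x hx => H x fun i => (hx i).trans_le hd) (fun a => by
      obtain ⟨δ, hδ, H⟩ := (hh a x₀ (by simpa using fun _ => hρ)).continuousAt one_pos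
      exact ⟨δ, hδ, fun x hx => by simpa [h0 a] using H x hx⟩)
  set N : K := n * C + 1 with hN
  have hN0 : 0 < N := by positivity
  refine ⟨min (min ρ σ₀) (1 / (2 * N)), by positivity, fun x hx a₀ => ?_⟩
  have hxρ : ∀ i, |x i - x₀ i| < ρ :=
    fun i => (hx i).trans_le ((min_le_left _ _).trans (min_le_left _ _))
  have hxσ : ∀ i, |x i - x₀ i| < σ₀ :=
    fun i => (hx i).trans_le ((min_le_left _ _).trans (min_le_right _ _))
  set s : K := 1 / (2 * N) with hs
  have hs0 : 0 < s := by positivity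
  have hxs : ∀ i, |x i - x₀ i| ≤ s := fun i => ((hx i).trans_le (min_le_right _ _)).le
  set γ : K → Fin n → K := fun t i => x₀ i + t * (x i - x₀ i) with hγ
  have hγle : ∀ t, 0 ≤ t → t ≤ 1 → ∀ i, |γ t i - x₀ i| ≤ |x i - x₀ i| := by
    intro t ht0 ht1 i
    simp only [hγ, add_sub_cancel_left, abs_mul, abs_of_nonneg ht0]
    exact mul_le_of_le_one_left (abs_nonneg _) ht1
  have hγdef : ∀ a, DefFn L (fun p : Unit → K => h a (γ (p ()))) := by
    intro a
    have := hdef a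
    simp only [hγ]
    infer_instance
  have hdefT : IsDefinable L {p : Fin 1 → K | p 0 ∈
      {r | ∃ t : K, 0 ≤ t ∧ t ≤ 1 ∧ ∃ a, r = |h a (γ t)|}} := by
    have : DefPred L (fun p : Fin 1 → K =>
        ∃ t : K, 0 ≤ t ∧ t ≤ 1 ∧ ∃ a, p 0 = |h a (γ t)|) := by
      have := hdef
      simp only [hγ]
      infer_instance
    exact this.out
  -- `M` is the supremum of all `|h a|` on the segment from `x₀` to `x`. The differentials there are
  -- at most `C * M`, so a segment short enough that `n * C * s ≤ 1 / 2` gives `M ≤ M / 2`.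
  obtain ⟨M, hM⟩ := hc _ hdefT ⟨_, 0, le_rfl, zero_le_one, a₀, rfl⟩ ⟨1, by
    rintro r ⟨t, ht0, ht1, a, rfl⟩
    exact (hb a (γ t) fun i => (hγle t ht0 ht1 i).trans_lt (hxσ i)).le⟩
  have hle : ∀ t, 0 ≤ t → t ≤ 1 → ∀ a, |h a (γ t)| ≤ M :=
    fun t h1 h2 a => hM.1 ⟨t, h1, h2, a, rfl⟩
  have hM0 : 0 ≤ M := (abs_nonneg _).trans (hle 0 le_rfl zero_le_one a₀)
  have hγ0 : γ 0 = x₀ := by ext i; simp [hγ]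
  have hγ1 : γ 1 = x := by ext i; simp [hγ]
  have hhalf : M ≤ M / 2 := by
    refine hM.2 ?_
    rintro r ⟨t₀, ht0, ht1, a, rfl⟩
    have := hc.mean_value_inequality (fun t => h a (γ t)) (hγdef a) ht0 (n * (C * M) * s) (by
      intro t ht ht' ε hε
      have ht1' : t ≤ 1 := ht'.trans ht1
      have hnear : ∀ i, |γ t i - x₀ i| < ρ := fun i => (hγle t ht ht1' i).trans_lt (hxρ i)
      obtain ⟨δ, hδ, H⟩ := hh a (γ t) hnear (ε / s) (by positivity)
      refine ⟨δ / s, by positivity, fun r hr0 hr1 hrt => ?_⟩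
      have hsub : ∀ i, γ r i - γ t i = (r - t) * (x i - x₀ i) := fun i => by
        simp only [hγ]; ring
      have hinc : ∀ i, |γ r i - γ t i| ≤ s * |r - t| := by
        intro i
        rw [hsub, abs_mul, mul_comm]
        exact mul_le_mul_of_nonneg_right (hxs i) (abs_nonneg _)
      have e1 := H (γ r) (γ t) (fun i => (hinc i).trans_lt (by
        rw [mul_comm]; exact (lt_div_iff₀ hs0).1 hrt)) (by simp [hδ]) (s * |r - t|) (by positivity)
        hinc
      have e2 := abs_sum_mul_le (Dh a (γ t)) (fun i => γ r i - γ t i) (s * |r - t|) hinc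
      have e3 : ∑ i, |Dh a (γ t) i| ≤ n * (C * M) := by
        calc ∑ i, |Dh a (γ t) i| ≤ ∑ _i : Fin n, C * M := Finset.sum_le_sum fun i _ =>
              hrel (γ t) hnear a i M (hle t ht ht1')
          _ = _ := by simp
      calc |h a (γ r) - h a (γ t)| = |(∑ i, Dh a (γ t) i * (γ r i - γ t i)) +
            (h a (γ r) - h a (γ t) - ∑ i, Dh a (γ t) i * (γ r i - γ t i))| := by ring_nf
        _ ≤ _ := abs_add_le _ _
        _ ≤ n * (C * M) * (s * |r - t|) + ε / s * (s * |r - t|) :=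
          add_le_add (e2.trans (mul_le_mul_of_nonneg_right e3 (by positivity))) e1
        _ = _ := by field_simp)
    rw [hγ0, h0, sub_zero, sub_zero] at this
    refine this.trans ?_
    have e : n * C * s ≤ 1 / 2 := by
      rw [hs, mul_one_div, div_le_iff₀ (by positivity)]
      linarith
    calc n * (C * M) * s * t₀ ≤ n * (C * M) * s * 1 :=
          mul_le_mul_of_nonneg_left ht1 (by positivity)
      _ = (n * C * s) * M := by ring
      _ ≤ 1 / 2 * M := mul_le_mul_of_nonneg_right e hM0
      _ = M / 2 := by ring
  have hMz : M = 0 := by linarith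
  have := hle 1 zero_le_one le_rfl a₀
  rw [hγ1, hMz] at this
  exact abs_nonpos_iff.1 this

/-- The component of the covector `D` along the coordinate `i` is removed by subtracting a
multiple of the covector `P`. -/
def eliminate (P : Fin n → K) (i : Fin n) : (Fin n → K) →ₗ[K] (Fin n → K) where
  toFun D := fun j => D j - D i / P i * P j
  map_add' D E := by ext j; simp only [Pi.add_apply]; ring
  map_smul' c D := by ext j; simp only [Pi.smul_apply, smul_eq_mul, RingHom.id_apply]; ring

theorem eliminate_self {P : Fin n → K} {i : Fin n} (h : P i ≠ 0) : eliminate P i P = 0 := by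
  ext j
  simp [eliminate, h]

/-- A relation between the reduced covectors becomes a relation between the original ones with
coefficient `c` on the last. If the pivot is zero, division by zero makes `c` and the elimination
trivial, so no assumption on it is needed. -/
theorem linearIndependent_eliminate {r : ℕ} {v : Fin (r + 1) → Fin n → K}
    (hv : LinearIndependent K v) (i : Fin n) :
    LinearIndependent K (fun j : Fin r => eliminate (v (Fin.last r)) i (v j.castSucc)) := by
  rw [Fintype.linearIndependent_iff] at hv ⊢
  intro g hg
  set c : K := - ((∑ j, g j * v j.castSucc i) / v (Fin.last r) i) with hc
  have := hv (Fin.snoc g c) (by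
    rw [Fin.sum_univ_castSucc]
    simp only [Fin.snoc_castSucc, Fin.snoc_last]
    rw [← hg]
    ext k
    simp only [Pi.add_apply, Finset.sum_apply, Pi.smul_apply, smul_eq_mul, eliminate,
      LinearMap.coe_mk, AddHom.coe_mk, mul_sub, Finset.sum_sub_distrib, hc, neg_mul,
      Finset.sum_div, Finset.sum_mul]
    rw [sub_eq_add_neg]
    congr 2
    exact Finset.sum_congr rfl fun j _ => by ring)
  intro j
  simpa using this j.castSucc

/-- Elimination is the pullback of covectors along `y ↦ Function.update y i (ξ y)`. The coordinate
`i` stays as a dummy variable, so solving equations successively never leaves `K ^ n`. -/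
theorem strictDiffAt_comp_update {g ξ : (Fin n → K) → K} {x D P : Fin n → K} {i : Fin n}
    (hg : StrictDiffAt g D (Function.update x i (ξ x)))
    (hξ : StrictDiffAt ξ (fun j => if j = i then 0 else - (P j / P i)) x) (hP : P i ≠ 0) :
    StrictDiffAt (fun y => g (Function.update y i (ξ y))) (eliminate P i D) x := by
  have := StrictDiffAt.comp (φ := fun y => Function.update y i (ξ y)) (x := x)
    (A := fun k => if k = i then (fun j => if j = i then 0 else - (P j / P i)) else Pi.single k 1)
    hg (by
      intro k
      by_cases hk : k = i
      · subst hk; simpa using hξ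
      · simpa [hk] using StrictDiffAt.proj k x)
  convert! this using 1
  ext j
  rw [← Finset.add_sum_erase _ _ (Finset.mem_univ i)]
  have e : ∀ k ∈ Finset.univ.erase i, D k * (if k = i then
      (fun j => if j = i then 0 else - (P j / P i)) else (Pi.single k 1 : Fin n → K)) j =
      if j = k then D k else 0 := by
    intro k hk
    rw [if_neg (Finset.ne_of_mem_erase hk), Pi.single_apply]
    simp
  rw [Finset.sum_congr rfl e, Finset.sum_ite_eq]
  by_cases hj : j = i
  · subst hj
    simp [eliminate, hP]
  · simp [eliminate, hj]
    ring

/-- Let `G` have independent differentials at the zero `x₀`. Functions `h` that vanish at `x₀` and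
whose differentials, on the zero set of `G`, are bounded by the values of `h` modulo the
differentials of `G`, vanish on the zero set of `G` near `x₀`. -/
theorem DefinablyComplete.eventually_eq_zero_on (hc : DefinablyComplete L K) (x₀ : Fin n → K)
    {r : ℕ} (G : Fin r → (Fin n → K) → K) (hGdef : ∀ j, DefFn L (G j))
    (DG : Fin r → (Fin n → K) → Fin n → K) (h : Fin q → (Fin n → K) → K)
    (hdef : ∀ a, DefFn L (h a)) (Dh : Fin q → (Fin n → K) → Fin n → K)
    {ρ C : K} (hρ : 0 < ρ) (hC : 0 ≤ C)
    (hG : ∀ j x, (∀ i, |x i - x₀ i| < ρ) → StrictDiffAt (G j) (DG j x) x)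
    (hh : ∀ a x, (∀ i, |x i - x₀ i| < ρ) → StrictDiffAt (h a) (Dh a x) x)
    (hindep : LinearIndependent K (fun j => DG j x₀)) (hG0 : ∀ j, G j x₀ = 0)
    (h0 : ∀ a, h a x₀ = 0)
    (hrel : ∀ x, (∀ i, |x i - x₀ i| < ρ) → (∀ j, G j x = 0) → ∀ a, ∃ μ : Fin r → K, ∀ i M,
      (∀ b, |h b x| ≤ M) → |(Dh a x - ∑ j, μ j • DG j x) i| ≤ C * M) :
    ∃ σ > 0, ∀ x, (∀ i, |x i - x₀ i| < σ) → (∀ j, G j x = 0) → ∀ a, h a x = 0 := by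
  induction r generalizing h Dh ρ C with
  | zero =>
    obtain ⟨σ, hσ, H⟩ := hc.eventually_eq_zero h hdef Dh x₀ hρ hC hh h0 (by
      intro x hx a i M hM
      obtain ⟨μ, hμ⟩ := hrel x hx (fun j => j.elim0) a
      simpa using hμ i M hM)
    exact ⟨σ, hσ, fun x hx _ => H x hx⟩
  | succ r ih =>
    obtain ⟨i, hi⟩ : ∃ i, DG (Fin.last r) x₀ i ≠ 0 := by
      by_contra! hcon
      exact hindep.ne_zero (Fin.last r) (funext hcon)
    have := hGdef (Fin.last r)
    obtain ⟨ξ, hξ, hξ0, σ, hσ, B, hσρ, hB0, H⟩ := hc.implicit_function (G (Fin.last r))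
      (DG (Fin.last r)) x₀ i hρ (hG (Fin.last r)) hi (hG0 _)
    set φ : (Fin n → K) → Fin n → K := fun x => Function.update x i (ξ x) with hφ
    have hφ0 : φ x₀ = x₀ := by simp [hφ, hξ0]
    have hφdef : ∀ k, DefFn L (fun x => φ x k) :=
      fun k => DefFn.update (fun x : Fin n → K => x) i k ξ
    -- The map `φ` projects onto the zero set of the last equation, which disappears from the
    -- system. Elimination subtracts a component of size at most `C * M` times a quotient bounded by
    -- `B`, hence the constant `C * (1 + B)`.
    obtain ⟨σ', hσ', H'⟩ := ih (fun j x => G j.castSucc (φ x))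
      (fun j => have := hGdef j.castSucc; DefFn.comp _ _)
      (fun j x => eliminate (DG (Fin.last r) (φ x)) i (DG j.castSucc (φ x)))
      (fun a x => h a (φ x)) (fun a => have := hdef a; DefFn.comp _ _)
      (fun a x => eliminate (DG (Fin.last r) (φ x)) i (Dh a (φ x))) hσ
      (C := C * (1 + B)) (by positivity)
      (fun j x hx => strictDiffAt_comp_update (hG j.castSucc _ (H x hx).1) (H x hx).2.2.2.2.1
        (H x hx).2.2.2.1)
      (fun a x hx => strictDiffAt_comp_update (hh a _ (H x hx).1) (H x hx).2.2.2.2.1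
        (H x hx).2.2.2.1)
      (by simp only [hφ0]; exact linearIndependent_eliminate hindep i)
      (fun j => by simp only [hφ0]; exact hG0 _) (fun a => by simp only [hφ0]; exact h0 a)
      (by
        intro x hx hGx a
        obtain ⟨hxρ, hlast, -, hne, -, hquot⟩ := H x hx
        have hGφ : ∀ j, G j (φ x) = 0 := fun j => by
          induction j using Fin.lastCases with
          | last => exact hlast
          | cast j => exact hGx j
        obtain ⟨μ, hμ⟩ := hrel (φ x) hxρ hGφ a
        refine ⟨fun j => μ j.castSucc, fun k M hM => ?_⟩
        set E := Dh a (φ x) - ∑ j, μ j • DG j (φ x) with hE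
        have e : eliminate (DG (Fin.last r) (φ x)) i (Dh a (φ x)) -
            ∑ j : Fin r, μ j.castSucc • eliminate (DG (Fin.last r) (φ x)) i (DG j.castSucc (φ x)) =
            eliminate (DG (Fin.last r) (φ x)) i E := by
          rw [hE, Fin.sum_univ_castSucc, map_sub, map_add, map_sum]
          simp only [map_smul]
          rw [eliminate_self hne, smul_zero, add_zero]
        rw [e]
        have e1 : eliminate (DG (Fin.last r) (φ x)) i E k =
            E k - E i * (DG (Fin.last r) (φ x) k / DG (Fin.last r) (φ x) i) := by
          simp only [eliminate, LinearMap.coe_mk, AddHom.coe_mk]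
          ring
        rw [e1]
        have hCM : 0 ≤ C * M := (abs_nonneg _).trans (hμ k M hM)
        calc _ ≤ _ := abs_sub _ _
          _ ≤ C * M + C * M * B := by
            refine add_le_add (hμ k M hM) ?_
            rw [abs_mul]
            exact mul_le_mul (hμ i M hM) (hquot k) (abs_nonneg _) hCM
          _ = _ := by ring)
    refine ⟨min σ σ', lt_min hσ hσ', fun x hx hGx a => ?_⟩
    have hxσ : ∀ i, |x i - x₀ i| < σ := fun i => (hx i).trans_le (min_le_left _ _)
    have hfix : φ x = x := by
      simp only [hφ, (H x hxσ).2.2.1 (hGx _), Function.update_eq_self]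
    have := H' x (fun i => (hx i).trans_le (min_le_right _ _))
      (fun j => by simp only [hfix]; exact hGx _) a
    simpa only [hfix] using this

end Complete

/-! ### Extension by zero of smooth functions on `U`. -/

section Extension

variable {L : FirstOrder.Language.{u, v}} {K : Type w} [L.Structure K]
  [Field K] [LinearOrder K] [IsStrictOrderedRing K] [TopologicalSpace K] [OrderTopology K]
  [hK : Fact (ExpandsOrderedField L K)] {n : ℕ} {U : Set (Fin n → K)}

/-- The extension of a function by zero outside its domain. -/
noncomputable def extendZero (g : U → K) : (Fin n → K) → K :=
  Function.extend Subtype.val g (0 : (Fin n → K) → K)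

theorem extendZero_coe (g : U → K) (x : U) : extendZero g x = g x :=
  Subtype.val_injective.extend_apply g _ x

theorem extendZero_of_notMem (g : U → K) {x : Fin n → K} (hx : x ∉ U) : extendZero g x = 0 := by
  refine Function.extend_apply' g _ x ?_
  rintro ⟨y, rfl⟩
  exact hx y.2

theorem IsDefinableFun.defFn_extendZero (hU : IsDefinable L U) {g : U → K}
    (hg : IsDefinableFun L g) : DefFn L (extendZero g) := by
  refine DefFn.of_graph _ ?_
  have h1 : DefPred L (fun q : Fin n ⊕ Unit → K =>
      ∃ x : U, q = Sum.elim (x : Fin n → K) (fun _ => g x)) := ⟨hg⟩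
  have h2 : DefPred L (fun q : Fin n ⊕ Unit → K => (fun i => q (Sum.inl i)) ∈ U) :=
    hU.defPred.comp (fun (q : Fin n ⊕ Unit → K) i => q (Sum.inl i))
  have h3 : ∀ q : Fin n ⊕ Unit → K, extendZero g (fun i => q (Sum.inl i)) = q (Sum.inr ()) ↔
      (∃ x : U, q = Sum.elim (x : Fin n → K) (fun _ => g x)) ∨
        ((fun i => q (Sum.inl i)) ∉ U ∧ q (Sum.inr ()) = 0) := by
    intro q
    by_cases hq : (fun i => q (Sum.inl i)) ∈ U
    · have e := extendZero_coe g ⟨_, hq⟩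
      simp only at e
      rw [e]
      constructor
      · intro h
        refine Or.inl ⟨⟨_, hq⟩, ?_⟩
        ext (i | i)
        · rfl
        · exact h.symm
      · rintro (⟨x, hx⟩ | ⟨h, -⟩)
        · have : (⟨_, hq⟩ : U) = x := Subtype.ext (funext fun i => congrFun hx (Sum.inl i))
          rw [this]
          exact (congrFun hx (Sum.inr ())).symm
        · exact absurd hq h
    · rw [extendZero_of_notMem g hq]
      constructor
      · intro h
        exact Or.inr ⟨hq, h.symm⟩
      · rintro (⟨x, hx⟩ | ⟨-, h⟩)
        · refine absurd ?_ hq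
          have : (fun i => q (Sum.inl i)) = x := funext fun i => congrFun hx (Sum.inl i)
          rw [this]
          exact x.2
        · exact h.symm
  simp only [h3]
  infer_instance

theorem continuousOn_extendZero {g : U → K} (hg : Continuous g) :
    ContinuousOn (extendZero g) U := by
  rw [continuousOn_iff_continuous_domRestrict]
  convert! hg using 1
  ext x
  exact extendZero_coe g x

theorem IsSmooth.continuous {g : U → K} (hg : IsSmooth g) : Continuous g := hg 0

theorem IsSmooth.hasPartialDerivAt {g : U → K} (hg : IsSmooth g) (i : Fin n) (x : U) :
    HasPartialDerivAt g i x (partialDeriv g i x) := by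
  obtain ⟨d, hd⟩ := ((hg 1).2 i).1 x
  rwa [hd.partialDeriv_eq]

theorem HasPartialDerivAt.extendZero {g : U → K} {i : Fin n} {x : U} {d : K}
    (h : HasPartialDerivAt g i x d) {ε : K} (hε : 0 < ε) :
    ∃ δ > 0, ∀ t, |t - (x : Fin n → K) i| < δ → |extendZero g (Function.update x i t) -
      extendZero g x - d * (t - (x : Fin n → K) i)| ≤ ε * |t - (x : Fin n → K) i| := by
  unfold HasPartialDerivAt at h
  rw [LinearOrderedAddCommGroup.tendsto_nhds] at h
  have h1 := h ε hε
  rw [eventually_nhdsWithin_iff] at h1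
  obtain ⟨δ, hδ, h2⟩ := (nhds_basis_abs_sub_lt (0 : K)).mem_iff.1 h1
  refine ⟨δ, hδ, fun t ht => ?_⟩
  rcases eq_or_ne t ((x : Fin n → K) i) with rfl | hne
  · simp
  have hne' : t - (x : Fin n → K) i ≠ 0 := sub_ne_zero.2 hne
  have h3 := h2 (show t - (x : Fin n → K) i ∈ {b | |b - 0| < δ} by simpa using ht) hne'
  have h4 : (x : Fin n → K) + Pi.single i (t - (x : Fin n → K) i) =
      Function.update (x : Fin n → K) i t := by
    ext j
    by_cases hj : j = i
    · subst hj; simp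
    · simp [hj]
  unfold diffQuot at h3
  rw [h4, ← extendZero_coe g x] at h3
  have h5 : 0 < |t - (x : Fin n → K) i| := abs_pos.2 hne'
  have h6 := (mul_lt_mul_of_pos_right h3 h5).le
  rw [← abs_mul, sub_mul, div_mul_cancel₀ _ hne'] at h6
  exact h6

/-- The gradient of `g`, extended by zero. -/
noncomputable def gradient (g : U → K) (x : Fin n → K) (i : Fin n) : K :=
  extendZero (partialDeriv g i) x

theorem gradient_coe (g : U → K) (x : U) : gradient g x = fun i => partialDeriv g i x := by
  ext i
  exact extendZero_coe _ x

theorem IsSmooth.strictDiffAt (hc : DefinablyComplete L K) (hUdef : IsDefinable L U)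
    (hUopen : IsOpen U) {g : U → K} (hg : IsSmooth g) (hgdef : IsDefinableFun L g)
    {x : Fin n → K} (hx : x ∈ U) : StrictDiffAt (extendZero g) (gradient g x) x := by
  obtain ⟨ρ, hρ, hρU⟩ := mem_nhds_iff_abs.1 (hUopen.mem_nhds hx)
  have := hgdef.defFn_extendZero hUdef
  refine hc.strictDiffAt (extendZero g) (gradient g) x hρ (fun y hy i ε hε => ?_) fun i ε hε => ?_
  · have h := (hg.hasPartialDerivAt i ⟨y, hρU y hy⟩).extendZero hε
    have e : partialDeriv g i ⟨y, hρU y hy⟩ = gradient g y i :=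
      (extendZero_coe (partialDeriv g i) ⟨y, hρU y hy⟩).symm
    rwa [e] at h
  · have hcont : Continuous (partialDeriv g i) := ((hg 1).2 i).2
    obtain ⟨δ, hδ, h⟩ := continuousWithinAt_iff_abs.1 (continuousOn_extendZero hcont x hx) ε hε
    exact ⟨min δ ρ, lt_min hδ hρ, fun y hy => (h y
      (hρU y fun i => (hy i).trans_le (min_le_right _ _))
      fun i => (hy i).trans_le (min_le_left _ _)).le⟩

end Extension

/-! ### Stability properties of definably meager sets. -/

section Meager

variable {L : FirstOrder.Language.{u, v}} {K : Type w} [L.Structure K] [LinearOrder K]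
  [TopologicalSpace K] {m : ℕ}

theorem DefinablyMeager.mono {X Y : Set (Fin m → K)} (hXY : X ⊆ Y) (hY : DefinablyMeager L Y) :
    DefinablyMeager L X := by
  obtain ⟨A, h1, h2, h3, h4⟩ := hY
  exact ⟨A, h1, h2, h3, hXY.trans h4⟩

theorem DefinablyMeager.empty : DefinablyMeager L (∅ : Set (Fin m → K)) :=
  ⟨fun _ => ∅, by simp [IsDefinableFamily, IsDefinable], monotone_const, fun _ => by simp, by simp⟩

theorem DefinablyMeager.union {X Y : Set (Fin m → K)} (hX : DefinablyMeager L X)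
    (hY : DefinablyMeager L Y) : DefinablyMeager L (X ∪ Y) := by
  obtain ⟨A, hA, hAmono, hAnd, hXA⟩ := hX
  obtain ⟨B, hB, hBmono, hBnd, hYB⟩ := hY
  refine ⟨fun t => A t ∪ B t, Set.Definable.union hA hB,
    fun s t hst => union_subset_union (hAmono hst) (hBmono hst), fun t => ?_, ?_⟩
  · unfold IsNowhereDense
    rw [closure_union, interior_union_isClosed_of_interior_empty isClosed_closure (hBnd t)]
    exact hAnd t
  · rw [iUnion_union_distrib]
    exact union_subset_union hXA hYB

end Meager

/-! ### The image of a stratum carrying a closed system. -/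

section Stratum

variable {L : FirstOrder.Language.{u, v}} {K : Type w} [L.Structure K]
  [Field K] [LinearOrder K] [IsStrictOrderedRing K] [TopologicalSpace K] [OrderTopology K]
  [hK : Fact (ExpandsOrderedField L K)] {n : ℕ} {U : Set (Fin n → K)} {q r m : ℕ}

/-- The functions `Φ` have independent differentials where `d ≠ 0`, and the differential of every
`h a` is there a combination of those of `Φ` modulo the ideal generated by `g`. -/
structure IsClosedSystem (g : Fin q → U → K) (Φ : Fin r → U → K) (d : U → K) {p : ℕ}
    (h : Fin p → U → K) : Prop where
  indep : ∀ x : U, d x ≠ 0 → LinearIndependent K (fun j i => partialDeriv (Φ j) i x)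
  rel : ∀ a, ∃ E : Fin n → Fin q → U → K, (∀ i b, Continuous (E i b)) ∧
    ∀ x : U, ∃ ν : Fin r → K, ∀ i,
      d x * partialDeriv (h a) i x - ∑ j, ν j * partialDeriv (Φ j) i x = ∑ b, E i b x * g b x

/-- Modulo the `dΦ_j`, the differentials of all `h a` are combinations of the `g b`, with
coefficients `E / d` bounded near `x₀`. As `g` vanishes at `x₀`, each `g b` is itself an increment
of a member of `h`, so the inequality closes up; this is why `g` is adjoined to `f`. The nearby
points `y` are not assumed to be zeros of `g`. -/
theorem IsClosedSystem.locally_constant (hc : DefinablyComplete L K) (hUdef : IsDefinable L U)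
    (hUopen : IsOpen U) {g : Fin q → U → K} {Φ : Fin r → U → K} {d f : U → K}
    (hS : IsClosedSystem g Φ d (Fin.cons f g : Fin (q + 1) → U → K))
    (hΦs : ∀ j, IsSmooth (Φ j)) (hΦd : ∀ j, IsDefinableFun L (Φ j))
    (hgs : ∀ j, IsSmooth (g j)) (hgd : ∀ j, IsDefinableFun L (g j))
    (hfs : IsSmooth f) (hfd : IsDefinableFun L f) (hd : Continuous d)
    {x₀ : U} (hd0 : d x₀ ≠ 0) (hg0 : ∀ b, g b x₀ = 0) :
    ∃ δ > 0, ∀ y : U, (∀ i, |(y : Fin n → K) i - (x₀ : Fin n → K) i| < δ) →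
      (∀ j, Φ j y = Φ j x₀) → f y = f x₀ := by
  set h : Fin (q + 1) → U → K := Fin.cons f g with hh
  have hhs : ∀ a, IsSmooth (h a) := Fin.cases hfs hgs
  have hhd : ∀ a, IsDefinableFun L (h a) := Fin.cases hfd hgd
  choose E hE ν hν using hS.rel
  obtain ⟨ρ₁, hρ₁, hρU⟩ := mem_nhds_iff_abs.1 (hUopen.mem_nhds x₀.2)
  have near : ∀ {φ : U → K}, ContinuousAt φ x₀ → ∀ ε > 0, ∃ δ > 0, ∀ y : U,
      (∀ i, |(y : Fin n → K) i - (x₀ : Fin n → K) i| < δ) → |φ y - φ x₀| < ε := by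
    intro φ hφ ε hε
    have h1 := (LinearOrderedAddCommGroup.tendsto_nhds.1 hφ) ε hε
    obtain ⟨s, hs, hsub⟩ := mem_nhds_subtype U x₀ _ |>.1 h1
    obtain ⟨δ, hδ, h2⟩ := mem_nhds_iff_abs.1 hs
    exact ⟨δ, hδ, fun y hy => hsub (h2 y hy)⟩
  obtain ⟨ρ₂, hρ₂, hdne⟩ := near hd.continuousAt |d x₀| (abs_pos.2 hd0)
  obtain ⟨ρ₃, hρ₃, hEb⟩ := exists_pos_forall_of_finite
    (P := fun (s : Fin (q + 1) × Fin n × Fin q) δ => ∀ y : U,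
      (∀ i, |(y : Fin n → K) i - (x₀ : Fin n → K) i| < δ) →
        |E s.1 s.2.1 s.2.2 y / d y - E s.1 s.2.1 s.2.2 x₀ / d x₀| < 1)
    (fun s δ δ' hd H y hy => H y fun i => (hy i).trans_le hd)
    (fun s => near (φ := fun y => E s.1 s.2.1 s.2.2 y / d y)
      ((hE _ _ _).continuousAt.div₀ hd.continuousAt hd0) 1 one_pos)
  set B : Fin (q + 1) → Fin n → Fin q → K := fun a i b => |E a i b x₀ / d x₀| + 1 with hB
  have hB0 : ∀ a i b, 0 ≤ B a i b := fun a i b => by positivity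
  set C : K := ∑ a, ∑ i, ∑ b, B a i b with hC
  have hBC : ∀ a i, ∑ b, B a i b ≤ C := fun a i =>
    (Finset.single_le_sum (f := fun i => ∑ b, B a i b)
      (fun i _ => Finset.sum_nonneg fun b _ => hB0 a i b) (Finset.mem_univ i)).trans
    (Finset.single_le_sum (f := fun a => ∑ i, ∑ b, B a i b)
      (fun a _ => Finset.sum_nonneg fun i _ => Finset.sum_nonneg fun b _ => hB0 a i b)
      (Finset.mem_univ a))
  have hC0 : 0 ≤ C := Finset.sum_nonneg fun a _ => Finset.sum_nonneg fun i _ =>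
    Finset.sum_nonneg fun b _ => hB0 a i b
  have hρ : 0 < min ρ₁ (min ρ₂ ρ₃) := lt_min hρ₁ (lt_min hρ₂ hρ₃)
  have hmemU : ∀ x : Fin n → K, (∀ i, |x i - (x₀ : Fin n → K) i| < min ρ₁ (min ρ₂ ρ₃)) → x ∈ U :=
    fun x hx => hρU x fun i => (hx i).trans_le (min_le_left _ _)
  have defsub : ∀ (φ : U → K), IsDefinableFun L φ → ∀ c,
      DefFn L (fun x : Fin n → K => extendZero φ x - c) := by
    intro φ hφ c
    have := hφ.defFn_extendZero hUdef
    infer_instance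
  obtain ⟨σ, hσ, H⟩ := hc.eventually_eq_zero_on (x₀ : Fin n → K)
    (fun j x => extendZero (Φ j) x - Φ j x₀) (fun j => defsub _ (hΦd j) _)
    (fun j => gradient (Φ j)) (fun a x => extendZero (h a) x - h a x₀)
    (fun a => defsub _ (hhd a) _) (fun a => gradient (h a)) hρ hC0
    (fun j x hx => ((hΦs j).strictDiffAt hc hUdef hUopen (hΦd j) (hmemU x hx)).sub_const _)
    (fun a x hx => ((hhs a).strictDiffAt hc hUdef hUopen (hhd a) (hmemU x hx)).sub_const _)
    (by simpa only [gradient_coe] using hS.indep x₀ hd0)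
    (fun j => by simp only [extendZero_coe, sub_self])
    (fun a => by simp only [extendZero_coe, sub_self]) (by
      intro x hx _ a
      obtain ⟨y, rfl⟩ : ∃ y : U, x = y := ⟨⟨x, hmemU x hx⟩, rfl⟩
      have hdy : d y ≠ 0 := by
        intro h0
        have := hdne y fun i => (hx i).trans_le ((min_le_right _ _).trans (min_le_left _ _))
        rw [h0, zero_sub, abs_neg] at this
        exact lt_irrefl _ this
      refine ⟨fun j => ν a y j / d y, fun i M hM => ?_⟩
      have e1 : (gradient (h a) y - ∑ j, (ν a y j / d y) • gradient (Φ j) y) i =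
          ∑ b, E a i b y / d y * g b y := by
        have h1 := hν a y i
        have h2 : ∑ b, E a i b y / d y * g b y = (∑ b, E a i b y * g b y) / d y := by
          rw [Finset.sum_div]
          exact Finset.sum_congr rfl fun b _ => by ring
        rw [h2, ← h1, sub_div, mul_div_cancel_left₀ _ hdy, Finset.sum_div]
        simp only [gradient_coe, Pi.sub_apply, Finset.sum_apply, Pi.smul_apply, smul_eq_mul]
        congr 1
        exact Finset.sum_congr rfl fun b _ => by ring
      rw [e1]
      have hM0 : 0 ≤ M := (abs_nonneg _).trans (hM 0)
      have hgM : ∀ b, |g b y| ≤ M := by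
        intro b
        have := hM b.succ
        simpa only [hh, Fin.cons_succ, extendZero_coe, hg0, sub_zero] using this
      calc |∑ b, E a i b y / d y * g b y| ≤ ∑ b, |E a i b y / d y * g b y| :=
            Finset.abs_sum_le_sum_abs _ _
        _ ≤ ∑ b, B a i b * M := by
          refine Finset.sum_le_sum fun b _ => ?_
          rw [abs_mul]
          refine mul_le_mul ?_ (hgM b) (abs_nonneg _) (hB0 a i b)
          have h1 := hEb (a, i, b) y
            fun i => (hx i).trans_le ((min_le_right _ _).trans (min_le_right _ _))
          have h2 := abs_sub_abs_le_abs_sub (E a i b y / d y) (E a i b x₀ / d x₀)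
          simp only at h1
          simp only [hB]
          linarith
        _ = (∑ b, B a i b) * M := by rw [Finset.sum_mul]
        _ ≤ C * M := mul_le_mul_of_nonneg_right (hBC a i) hM0)
  refine ⟨σ, hσ, fun y hy hΦy => ?_⟩
  have := H y hy (fun j => by simp only [extendZero_coe, hΦy j, sub_self]) 0
  simpa only [hh, Fin.cons_zero, extendZero_coe, sub_eq_zero] using this

/-- On the zeros of `g`, fixing all `F i` with `i ≠ l` fixes every `Φ j`, so `locally_constant`
makes `F l` locally constant on the fibres of the others. The stratum is exhausted by closed bounded
sets `C t`. -/
theorem IsClosedSystem.definablyMeager (hc : DefinablyComplete L K) (hUdef : IsDefinable L U)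
    (hUopen : IsOpen U) {M : Subring (U → K)} (hM : IsNoetherianDifferentialRing L M)
    {g : Fin q → U → K} (hg : ∀ b, g b ∈ M) {Φ : Fin r → U → K} {d : U → K} (hd : d ∈ M)
    {F : Fin m → U → K} (hF : ∀ i, F i ∈ M) {l : Fin m}
    (hΦ : ∀ j, (∃ b, Φ j = g b) ∨ ∃ i, i ≠ l ∧ Φ j = F i)
    (hS : IsClosedSystem g Φ d (Fin.cons (F l) g : Fin (q + 1) → U → K)) :
    DefinablyMeager L ((fun x j => F j x) '' {x : U | (∀ b, g b x = 0) ∧ d x ≠ 0}) := by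
  have hΦM : ∀ j, Φ j ∈ M := by
    intro j
    rcases hΦ j with ⟨b, hb⟩ | ⟨i, -, hi⟩
    · rw [hb]; exact hg b
    · rw [hi]; exact hF i
  have hext : ∀ φ ∈ M, DefFn L (extendZero φ) := fun φ hφ =>
    (hM.definable φ hφ).defFn_extendZero hUdef
  have hcon : ∀ φ ∈ M, ContinuousOn (extendZero φ) U := fun φ hφ =>
    continuousOn_extendZero (hM.smooth φ hφ).continuous
  have hgdef : ∀ b, DefFn L (extendZero (g b)) := fun b => hext _ (hg b)
  have hFdef : ∀ b, DefFn L (extendZero (F b)) := fun b => hext _ (hF b)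
  have hddef : DefFn L (extendZero d) := hext _ hd
  -- Bounded by `t` and at distance at least `1 / t` from the complement of `U`, written without
  -- division. `C t` also asks for `1 / t ≤ |d|`, which keeps it closed.
  set W : K → Set (Fin n → K) := fun t =>
    {x | (∀ i, |x i| ≤ t) ∧ ∀ y : Fin n → K, y ∉ U → ∃ i, 1 ≤ t * |x i - y i|} with hW
  set C : K → Set (Fin n → K) := fun t => {x | 0 < t ∧ ((∀ i, |x i| ≤ t) ∧
    ∀ y : Fin n → K, y ∉ U → ∃ i, 1 ≤ t * |x i - y i|) ∧
    (∀ b, extendZero (g b) x = 0) ∧ 1 ≤ t * |extendZero d x|} with hC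
  have hWU : ∀ t, W t ⊆ U := by
    intro t x hx
    by_contra hxU
    obtain ⟨i, hi⟩ := hx.2 x hxU
    rw [sub_self, abs_zero, mul_zero] at hi
    exact absurd hi (not_le.2 one_pos)
  have hCW : ∀ t, C t ⊆ W t := fun t x hx => hx.2.1
  have hUpred : ∀ {κ : Type} (G : (κ → K) → (Fin n → K)) [∀ k, DefFn L (fun p => G p k)],
      DefPred L (fun p => G p ∈ U) := fun G _ => hUdef.defPred.comp G
  have hCdef : DefPred L (fun p : Fin n ⊕ Unit → K =>
      (fun i => p (Sum.inl i)) ∈ C (p (Sum.inr ()))) := by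
    simp only [hC, mem_ofPred_eq]
    infer_instance
  have hCt : ∀ t, DefPred L (fun p : Fin n → K => p ∈ C t) := by
    intro t
    simp only [hC, mem_ofPred_eq]
    infer_instance
  have hWclosed : ∀ t, IsClosed (W t) := by
    intro t
    have e : W t = (⋂ i, {x : Fin n → K | |x i| ≤ t}) ∩
        ⋂ y ∈ Uᶜ, ⋃ i, {x : Fin n → K | 1 ≤ t * |x i - y i|} := by
      ext x
      simp [hW]
    rw [e]
    refine (isClosed_iInter fun i => ?_).inter (isClosed_biInter fun y _ =>
      isClosed_iUnion_of_finite fun i => ?_)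
    · exact isClosed_le (continuous_apply i).abs continuous_const
    · exact isClosed_le continuous_const
        (continuous_const.mul ((continuous_apply i).sub continuous_const).abs)
  have hCclosed : ∀ t, IsClosed (C t) := by
    intro t
    by_cases ht : 0 < t
    · have e : C t = (W t ∩ ⋂ b, (W t ∩ extendZero (g b) ⁻¹' {0})) ∩
          (W t ∩ (fun x => t * |extendZero d x|) ⁻¹' Ici 1) := by
        ext x
        simp only [hC, hW, ht, mem_ofPred_eq, mem_inter_iff, mem_iInter, mem_preimage,
          mem_singleton_iff, mem_Ici, true_and]
        exact ⟨fun ⟨h1, h2, h3⟩ => ⟨⟨h1, fun b => ⟨h1, h2 b⟩⟩, h1, h3⟩,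
          fun ⟨⟨h1, h2⟩, _, h3⟩ => ⟨h1, fun b => (h2 b).2, h3⟩⟩
      rw [e]
      refine ((hWclosed t).inter (isClosed_iInter fun b => ?_)).inter ?_
      · exact ((hcon _ (hg b)).mono (hWU t)).preimage_isClosed_of_isClosed (hWclosed t)
          isClosed_singleton
      · exact (continuousOn_const.mul ((hcon _ hd).mono (hWU t)).abs).preimage_isClosed_of_isClosed
          (hWclosed t) isClosed_Ici
    · have e : C t = ∅ := by
        ext x
        simp [hC, ht]
      rw [e]
      exact isClosed_empty
  refine ⟨fun t => (fun x i => extendZero (F i) x) '' C t, ?_, ?_, ?_, ?_⟩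
  · have : DefPred L (fun p : Fin m ⊕ Unit → K => ∃ x : Fin n → K, x ∈ C (p (Sum.inr ())) ∧
        ∀ i, extendZero (F i) x = p (Sum.inl i)) := by
      have : DefPred L (fun p : (Fin m ⊕ Unit) ⊕ Fin n → K =>
          (fun i => p (Sum.inr i)) ∈ C (p (Sum.inl (Sum.inr ())))) := by
        simp only [hC, mem_ofPred_eq]
        infer_instance
      infer_instance
    unfold IsDefinableFamily
    convert! this.out using 1
    ext p
    simp only [mem_ofPred_eq, mem_image]
    exact exists_congr fun x => and_congr_right fun _ => funext_iff
  · intro s t hst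
    refine image_mono fun x hx => ?_
    refine ⟨hx.1.trans_le hst, ⟨fun i => (hx.2.1.1 i).trans hst, fun y hy => ?_⟩, hx.2.2.1,
      hx.2.2.2.trans (mul_le_mul_of_nonneg_right hst (abs_nonneg _))⟩
    obtain ⟨i, hi⟩ := hx.2.1.2 y hy
    exact ⟨i, hi.trans (mul_le_mul_of_nonneg_right hst (abs_nonneg _))⟩
  · intro t
    have := hCt t
    refine hc.isNowhereDense_image (hCclosed t) (u := fun _ => -t) (v := fun _ => t)
      (fun x hx => ⟨fun i => (abs_le.1 (hx.2.1.1 i)).1, fun i => (abs_le.1 (hx.2.1.1 i)).2⟩)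
      (fun i => extendZero (F i)) (fun i => (hcon _ (hF i)).mono ((hCW t).trans (hWU t))) l ?_
    intro x hx
    have hxU : x ∈ U := hWU t (hCW t hx)
    have val : ∀ (φ : U → K) (z : Fin n → K) (hz : z ∈ U), extendZero φ z = φ ⟨z, hz⟩ :=
      fun φ z hz => extendZero_coe φ ⟨z, hz⟩
    have hgx : ∀ z ∈ C t, ∀ hz : z ∈ U, ∀ b, g b ⟨z, hz⟩ = 0 := fun z hzC hz b => by
      rw [← val (g b) z hz]; exact hzC.2.2.1 b
    obtain ⟨δ, hδ, H⟩ := hS.locally_constant hc hUdef hUopen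
      (fun j => hM.smooth _ (hΦM j)) (fun j => hM.definable _ (hΦM j))
      (fun j => hM.smooth _ (hg j)) (fun j => hM.definable _ (hg j))
      (hM.smooth _ (hF l)) (hM.definable _ (hF l)) (hM.smooth _ hd).continuous
      (x₀ := ⟨x, hxU⟩) (by
        intro h0
        have := hx.2.2.2
        rw [val d x hxU, h0, abs_zero, mul_zero] at this
        exact absurd this (not_le.2 one_pos)) (hgx x hx hxU)
    refine ⟨δ, hδ, fun y hy hyx hyF => ?_⟩
    have hyU : y ∈ U := hWU t (hCW t hy)
    rw [val _ y hyU, val _ x hxU]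
    refine H ⟨y, hyU⟩ hyx fun j => ?_
    rcases hΦ j with ⟨b, hb⟩ | ⟨i, hi, hΦi⟩
    · rw [hb, hgx y hy, hgx x hx]
    · rw [hΦi, ← val (F i) y hyU, ← val (F i) x hxU]
      exact hyF i hi
  · rintro _ ⟨x, ⟨hgx, hdx⟩, rfl⟩
    obtain ⟨δ, hδ, hδU⟩ := mem_nhds_iff_abs.1 (hUopen.mem_nhds x.2)
    have hd0 : 0 < |d x| := abs_pos.2 hdx
    set t : K := ∑ i, |(x : Fin n → K) i| + 1 / δ + 1 / |d x| with ht
    have hs : 0 ≤ ∑ i, |(x : Fin n → K) i| := Finset.sum_nonneg fun i _ => abs_nonneg _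
    have h1 : 0 < 1 / δ := by positivity
    have h2 : 0 < 1 / |d x| := by positivity
    refine mem_iUnion.2 ⟨t, x, ⟨by linarith, ⟨fun i => ?_, fun y hy => ?_⟩, fun b => ?_, ?_⟩, ?_⟩
    · have := Finset.single_le_sum (f := fun i => |(x : Fin n → K) i|)
        (fun i _ => abs_nonneg _) (Finset.mem_univ i)
      linarith
    · obtain ⟨i, hi⟩ : ∃ i, δ ≤ |y i - (x : Fin n → K) i| := by
        by_contra! hcon
        exact hy (hδU y hcon)
      refine ⟨i, ?_⟩
      rw [abs_sub_comm]
      calc (1 : K) = 1 / δ * δ := by field_simp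
        _ ≤ t * |y i - (x : Fin n → K) i| :=
          mul_le_mul (by linarith) hi hδ.le (by linarith)
    · rw [extendZero_coe]; exact hgx b
    · rw [extendZero_coe]
      calc (1 : K) = 1 / |d x| * |d x| := by field_simp
        _ ≤ t * |d x| := mul_le_mul_of_nonneg_right (by linarith) hd0.le
    · ext i
      exact extendZero_coe _ _

end Stratum

/-! ### Bases among covectors, minors and Cramer's rule. -/

section LinearAlgebra

variable {K : Type w} [Field K] {n q m r : ℕ}

theorem exists_dotProduct_eq {ι : Type*} [Finite ι] {v : ι → Fin n → K}
    (hv : LinearIndependent K v) (y : ι → K) : ∃ w, ∀ t, v t ⬝ᵥ w = y t := by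
  cases nonempty_fintype ι
  have h1 : (Matrix.of v).rank = Fintype.card ι := LinearIndependent.rank_matrix hv
  have h2 : LinearMap.range (Matrix.of v).mulVecLin = ⊤ := by
    apply Submodule.eq_top_of_finrank_eq
    rw [Module.finrank_fintype_fun_eq_card]
    exact h1
  obtain ⟨w, hw⟩ := LinearMap.range_eq_top.1 h2 y
  exact ⟨w, fun t => congrFun hw t⟩

theorem exists_minor_ne_zero {v : Fin r → Fin n → K} (hv : LinearIndependent K v) :
    ∃ c : Fin r → Fin n, (Matrix.of fun j k => v j (c k)).det ≠ 0 := by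
  have h1 : (Matrix.of v).rank = r := by
    simpa using LinearIndependent.rank_matrix (M := Matrix.of v) hv
  rw [Matrix.rank_eq_finrank_span_cols] at h1
  obtain ⟨f, hf, -, hfi⟩ := Submodule.exists_fun_fin_finrank_span_eq K (range (Matrix.of v).col)
  choose c hc using hf
  refine ⟨fun k => c (Fin.cast h1.symm k), ?_⟩
  rw [← isUnit_iff_ne_zero, ← Matrix.isUnit_iff_isUnit_det,
    ← Matrix.linearIndependent_cols_iff_isUnit]
  have := hfi.comp (Fin.cast h1.symm) (Fin.cast_injective _)
  convert! this using 1
  ext k j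
  exact congrFun (hc (Fin.cast h1.symm k)) j

/-- A basis of the span of the `inl` vectors is extended by `inr` vectors. If it used all of the
latter, their values could be prescribed on a vector killed by the former, contrary to `hv`. -/
theorem exists_basis_avoiding (v : Fin q ⊕ Fin m → Fin n → K)
    (hv : ¬ ∀ y : Fin m → K, ∃ w, (∀ b, v (Sum.inl b) ⬝ᵥ w = 0) ∧ ∀ i, v (Sum.inr i) ⬝ᵥ w = y i) :
    ∃ (r : ℕ) (e : Fin r → Fin q ⊕ Fin m) (l : Fin m), (∀ j, e j ≠ Sum.inr l) ∧
      LinearIndependent K (fun j => v (e j)) ∧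
      ∀ s, v s ∈ Submodule.span K (range fun j => v (e j)) := by
  obtain ⟨s, hsl, -, hspan, hs⟩ := exists_linearIndepOn_extension (v := v)
    (linearIndepOn_empty K v) (empty_subset (range Sum.inl))
  obtain ⟨b, -, hsb, hbspan, hb⟩ := exists_linearIndepOn_extension hs (subset_univ s)
  by_cases hl : ∃ l, Sum.inr l ∉ b
  · obtain ⟨l, hl⟩ := hl
    have := Fintype.ofFinite b
    let e : Fin (Fintype.card b) ≃ b := (Fintype.equivFin b).symm
    refine ⟨Fintype.card b, fun j => e j, l, fun j hj => hl (hj ▸ (e j).2), ?_, fun t => ?_⟩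
    · exact LinearIndependent.comp hb e e.injective
    · have h1 := hbspan (mem_image_of_mem v (mem_univ t))
      rw [image_eq_range, ← e.surjective.range_comp (fun x : b => v x)] at h1
      exact h1
  · push Not at hl
    refine absurd (fun y => ?_) hv
    obtain ⟨w, hw⟩ := exists_dotProduct_eq (ι := b) hb
      (fun t => Sum.elim (fun _ => 0) y (t : Fin q ⊕ Fin m))
    refine ⟨w, fun a => ?_, fun i => hw ⟨Sum.inr i, hl i⟩⟩
    have h1 := hspan (mem_image_of_mem v (mem_range_self a))
    have h2 : Submodule.span K (v '' s) ≤ LinearMap.ker ((dotProductBilin K K).flip w) := by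
      rw [Submodule.span_le]
      rintro _ ⟨t, ht, rfl⟩
      obtain ⟨a', rfl⟩ := hsl ht
      exact hw ⟨Sum.inl a', hsb ht⟩
    exact h2 h1

theorem linearIndependent_of_minor {v : Fin r → Fin n → K} {c : Fin r → Fin n}
    (h : (Matrix.of fun j k => v j (c k)).det ≠ 0) : LinearIndependent K v := by
  have := Matrix.linearIndependent_rows_of_det_ne_zero h
  exact LinearIndependent.of_comp (LinearMap.funLeft K K c) this

/-- Cramer's rule for a covector in the span of the rows of a matrix. -/
theorem cramer_of_mem_span {v : Fin r → Fin n → K} (c : Fin r → Fin n) {w : Fin n → K}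
    (hw : w ∈ Submodule.span K (range v)) (i : Fin n) :
    (Matrix.of fun j k => v j (c k)).det * w i =
      ∑ j, (∑ k, w (c k) * (Matrix.of fun j k => v j (c k)).adjugate k j) * v j i := by
  obtain ⟨μ, rfl⟩ := (Submodule.mem_span_range_iff_exists_fun K).1 hw
  set A : Matrix (Fin r) (Fin r) K := Matrix.of fun j k => v j (c k) with hA
  have h1 : ∀ j, ∑ k, (∑ j, μ j • v j) (c k) * A.adjugate k j = A.det * μ j := by
    intro j
    have e1 : (fun k => (∑ j, μ j • v j) (c k)) = Matrix.vecMul μ A := by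
      ext k
      simp [Matrix.vecMul, dotProduct, hA]
    have e2 : Matrix.vecMul (Matrix.vecMul μ A) A.adjugate = A.det • μ := by
      rw [Matrix.vecMul_vecMul, Matrix.mul_adjugate, Matrix.vecMul_smul, Matrix.vecMul_one]
    have e3 := congrFun e2 j
    rw [← e1] at e3
    exact e3
  simp only [h1]
  simp only [Finset.sum_apply, Pi.smul_apply, smul_eq_mul, Finset.mul_sum, mul_assoc]

end LinearAlgebra

/-! ### Construction of closed systems and the Noetherian induction. -/

section Main

variable {L : FirstOrder.Language.{u, v}} {K : Type w} [L.Structure K]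
  [Field K] [LinearOrder K] [IsStrictOrderedRing K] [TopologicalSpace K] [OrderTopology K]
  {n : ℕ} {U : Set (Fin n → K)} {q m : ℕ}

/-- Evaluation at a point, on a ring of functions. -/
def evalAt (M : Subring (U → K)) (x : U) : M →+* K := (Pi.evalRingHom (fun _ => K) x).comp M.subtype

/-- The `i`-th partial derivative, on a ring of functions closed under it. -/
noncomputable def IsNoetherianDifferentialRing.pderiv {M : Subring (U → K)}
    (hM : IsNoetherianDifferentialRing L M) (i : Fin n) (φ : M) : M :=
  ⟨partialDeriv (φ : U → K) i, hM.partialDeriv_mem _ φ.2 i⟩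

/-- The span of the differentials of a family of functions. -/
noncomputable def differentialSpan {M : Subring (U → K)} {α : Type*} (Ψ : α → M) (x : U) :
    Submodule K (Fin n → K) :=
  Submodule.span K (range fun s i => partialDeriv (Ψ s : U → K) i x)

/-- If every function of `M` vanishing on `T` is in the ideal generated by `g`, then at a singular
point of `T` of maximal rank some system formed by functions among `g` and `F` is closed. -/
theorem IsNoetherianDifferentialRing.exists_isClosedSystem {M : Subring (U → K)}
    (hM : IsNoetherianDifferentialRing L M) (g : Fin q → M) (F : Fin m → M) (T : Set U)
    (hT : ∀ φ : M, (∀ x ∈ T, (φ : U → K) x = 0) → φ ∈ Ideal.span (range g)) {x : U}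
    (hmax : ∀ y ∈ T, Module.finrank K (differentialSpan (Sum.elim g F) y) ≤
      Module.finrank K (differentialSpan (Sum.elim g F) x))
    (hsing : ¬ ∀ y : Fin m → K, ∃ w : Fin n → K,
      (∀ b, (fun i => partialDeriv (g b : U → K) i x) ⬝ᵥ w = 0) ∧
      ∀ j, (fun i => partialDeriv (F j : U → K) i x) ⬝ᵥ w = y j) :
    ∃ (r : ℕ) (Φ : Fin r → U → K) (l : Fin m) (d : M), (d : U → K) x ≠ 0 ∧
      (∀ j, (∃ b, Φ j = g b) ∨ ∃ i, i ≠ l ∧ Φ j = F i) ∧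
      IsClosedSystem (fun b => (g b : U → K)) Φ d
        (Fin.cons (F l : U → K) (fun b => (g b : U → K)) : Fin (q + 1) → U → K) := by
  set Ψ : Fin q ⊕ Fin m → M := Sum.elim g F with hΨ
  set v : U → Fin q ⊕ Fin m → Fin n → K := fun y s i => partialDeriv (Ψ s : U → K) i y with hv
  obtain ⟨r, e, l, hel, hindep, hspan⟩ := exists_basis_avoiding (v x) hsing
  obtain ⟨c, hdet⟩ := exists_minor_ne_zero hindep
  -- The matrix has entries in `M`, so its determinant and adjugate also belong to `M`; evaluation
  -- at a point is a ring homomorphism and commutes with both.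
  set A : Matrix (Fin r) (Fin r) M := Matrix.of fun j k => hM.pderiv (c k) (Ψ (e j)) with hA
  have hAy : ∀ y, A.map (evalAt M y) = Matrix.of fun j k => v y (e j) (c k) := fun y => rfl
  have hdetA : ∀ y, (A.det : U → K) y = (Matrix.of fun j k => v y (e j) (c k)).det := by
    intro y
    have := (evalAt M y).map_det A
    rw [RingHom.mapMatrix_apply, hAy] at this
    exact this
  have hadj : ∀ y k j, (A.adjugate k j : U → K) y =
      (Matrix.of fun j k => v y (e j) (c k)).adjugate k j := by
    intro y k j
    have := congrFun (congrFun ((evalAt M y).map_adjugate A) k) j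
    rw [RingHom.mapMatrix_apply, RingHom.mapMatrix_apply, hAy] at this
    exact this
  -- A nonzero minor keeps the `r` chosen differentials independent, and `r` is the maximal rank on
  -- `T`, so they still span.
  have hrank : ∀ y ∈ T, (A.det : U → K) y ≠ 0 → ∀ s,
      v y s ∈ Submodule.span K (range fun j => v y (e j)) := by
    intro y hy hdy s
    rw [hdetA] at hdy
    have hle : ∀ z, Submodule.span K (range fun j => v z (e j)) ≤ Submodule.span K (range (v z)) :=
      fun z => Submodule.span_mono (range_comp_subset_range e (v z))
    have hx : Submodule.span K (range (v x)) = Submodule.span K (range fun j => v x (e j)) :=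
      le_antisymm (Submodule.span_le.2 (range_subset_iff.2 hspan)) (hle x)
    have h1 : Module.finrank K (Submodule.span K (range (v x))) = r := by
      rw [hx, finrank_span_eq_card hindep, Fintype.card_fin]
    have h2 : Module.finrank K (Submodule.span K (range fun j => v y (e j))) = r := by
      rw [finrank_span_eq_card (linearIndependent_of_minor hdy), Fintype.card_fin]
    have h3 := Submodule.eq_of_le_of_finrank_le (hle y) (by
      rw [h2, ← h1]
      exact hmax y hy)
    rw [h3]
    exact Submodule.subset_span (mem_range_self s)
  -- The defect in Cramer's rule, multiplied once more by the determinant so that it vanishes on all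
  -- of `T`, including where the minor is zero. Hence `d` is the square of the minor.
  set R : Fin q ⊕ Fin m → Fin n → M := fun s i => A.det * (A.det * hM.pderiv i (Ψ s) -
    ∑ j, (∑ k, hM.pderiv (c k) (Ψ s) * A.adjugate k j) * hM.pderiv i (Ψ (e j))) with hR
  have hRval : ∀ s i y, (R s i : U → K) y = (A.det : U → K) y * ((A.det : U → K) y * v y s i -
      ∑ j, (∑ k, v y s (c k) * (A.adjugate k j : U → K) y) * v y (e j) i) := by
    intro s i y
    have : evalAt M y (R s i) = evalAt M y A.det * (evalAt M y A.det * evalAt M y (hM.pderiv i (Ψ s))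
        - ∑ j, (∑ k, evalAt M y (hM.pderiv (c k) (Ψ s)) * evalAt M y (A.adjugate k j)) *
          evalAt M y (hM.pderiv i (Ψ (e j)))) := by
      simp only [hR, map_mul, map_sub, map_sum]
    exact this
  have hRmem : ∀ s i, R s i ∈ Ideal.span (range g) := by
    intro s i
    refine hT _ fun y hy => ?_
    rw [hRval]
    by_cases hdy : (A.det : U → K) y = 0
    · rw [hdy, zero_mul]
    · have := cramer_of_mem_span c (hrank y hy hdy s) i
      simp only [hadj, hdetA]
      rw [this, sub_self, mul_zero]
  have hrel : ∀ s, ∃ E : Fin n → Fin q → U → K, (∀ i b, Continuous (E i b)) ∧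
      ∀ y : U, ∃ ν : Fin r → K, ∀ i, ((A.det * A.det : M) : U → K) y * partialDeriv (Ψ s : U → K) i y -
        ∑ j, ν j * partialDeriv (Ψ (e j) : U → K) i y = ∑ b, E i b y * (g b : U → K) y := by
    intro s
    choose E hE using fun i => (Ideal.mem_span_range_iff_exists_fun).1 (hRmem s i)
    refine ⟨fun i b => (E i b : U → K), fun i b => (hM.smooth _ (E i b).2).continuous, fun y =>
      ⟨fun j => (A.det : U → K) y * ∑ k, v y s (c k) * (A.adjugate k j : U → K) y, fun i => ?_⟩⟩
    have h1 : evalAt M y (∑ b, E i b * g b) = evalAt M y (R s i) := by rw [hE i]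
    rw [map_sum] at h1
    simp only [map_mul] at h1
    have h2 : ∑ b, (E i b : U → K) y * (g b : U → K) y = (R s i : U → K) y := h1
    rw [h2, hRval, mul_sub, Finset.mul_sum]
    congr 1
    · exact mul_assoc _ _ _
    · exact Finset.sum_congr rfl fun j _ => mul_assoc _ _ _
  refine ⟨r, fun j => Ψ (e j), l, A.det * A.det, ?_, fun j => ?_, ⟨fun y hy => ?_, ?_⟩⟩
  · have : (A.det : U → K) x ≠ 0 := by rw [hdetA]; exact hdet
    exact mul_ne_zero this this
  · rcases hj : e j with b | i
    · exact Or.inl ⟨b, by simp [hΨ, hj]⟩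
    · exact Or.inr ⟨i, fun h => hel j (h ▸ hj), by simp [hΨ, hj]⟩
  · have : (A.det : U → K) y ≠ 0 := left_ne_zero_of_mul (a := (A.det : U → K) y) hy
    rw [hdetA] at this
    exact linearIndependent_of_minor this
  · intro a
    induction a using Fin.cases with
    | zero => exact hrel (Sum.inr l)
    | succ b => exact hrel (Sum.inl b)

theorem not_forall_of_mem_singularPoints {r : ℕ} {H : Fin r → U → K} {F : Fin m → U → K} {x : U}
    (hx : x ∈ singularPoints H F) : ¬ ∀ y : Fin m → K, ∃ w : Fin n → K,
      (∀ b, (fun i => partialDeriv (H b) i x) ⬝ᵥ w = 0) ∧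
      ∀ j, (fun i => partialDeriv (F j) i x) ⬝ᵥ w = y j := by
  intro h
  refine hx.2 fun y => ?_
  obtain ⟨w, hw, hwF⟩ := h y
  exact ⟨⟨w, funext hw⟩, funext hwF⟩

theorem DefinablyComplete.definablyMeager_singularValues [hK : Fact (ExpandsOrderedField L K)]
    (hc : DefinablyComplete L K) (hUdef : IsDefinable L U) (hUopen : IsOpen U)
    {M : Subring (U → K)} (hM : IsNoetherianDifferentialRing L M) {r : ℕ}
    {H : Fin r → U → K} (hH : ∀ j, H j ∈ M) {F : Fin m → U → K} (hF : ∀ j, F j ∈ M) :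
    DefinablyMeager L (singularValues H F) := by
  have := hM.noetherian
  have claim : ∀ I : Ideal M, DefinablyMeager L ((fun x j => F j x) ''
      {x | x ∈ singularPoints H F ∧ ∀ φ ∈ I, (φ : U → K) x = 0}) := by
    intro I
    induction I using IsNoetherian.induction with
    | hgt I ih =>
    set T : Set U := {x | x ∈ singularPoints H F ∧ ∀ φ ∈ I, (φ : U → K) x = 0} with hTdef
    have hsup : ∀ φ : M, φ ∉ I → DefinablyMeager L ((fun x j => F j x) ''
        {x | x ∈ T ∧ (φ : U → K) x = 0}) := by
      intro φ hφ
      refine (ih (I ⊔ Ideal.span {φ}) ?_).mono (image_mono ?_)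
      · refine lt_of_le_of_ne le_sup_left fun h => hφ ?_
        rw [h]
        exact le_sup_right (a := I) (Ideal.mem_span_singleton_self φ)
      · rintro x ⟨⟨hxs, hxI⟩, hxφ⟩
        refine ⟨hxs, fun ψ hψ => ?_⟩
        have : I ⊔ Ideal.span {φ} ≤ RingHom.ker (evalAt M x) :=
          sup_le (fun χ hχ => hxI χ hχ) (by
            rw [Ideal.span_le, singleton_subset_iff]
            exact hxφ)
        exact this hψ
    by_cases hvan : ∃ φ : M, φ ∉ I ∧ ∀ x ∈ T, (φ : U → K) x = 0
    · obtain ⟨φ, hφ, hφT⟩ := hvan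
      refine (hsup φ hφ).mono (image_mono ?_)
      exact fun x hx => ⟨hx, hφT x hx⟩
    push Not at hvan
    -- From here on `I` is the full vanishing ideal of `T`, so a relation that holds on `T` holds on
    -- `U` modulo `I`.
    have hI : ∀ φ : M, (∀ x ∈ T, (φ : U → K) x = 0) → φ ∈ I := by
      intro φ hφ
      by_contra hcon
      obtain ⟨x, hx, hne⟩ := hvan φ hcon
      exact hne (hφ x hx)
    rcases T.eq_empty_or_nonempty with hTe | hTne
    · rw [hTe, image_empty]
      exact DefinablyMeager.empty
    obtain ⟨q, g, hgI⟩ := Submodule.fg_iff_exists_fin_generating_family.1 (IsNoetherian.noetherian I)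
    let H' : Fin r → M := fun j => ⟨H j, hH j⟩
    let F' : Fin m → M := fun j => ⟨F j, hF j⟩
    -- `H` lies in `I`; listing it among the generators makes vectors killed by all `dg'` tangent to
    -- `V`, so singularity of `x` is the failure of solvability required below.
    let g' : Fin (q + r) → M := Fin.append g H'
    have hH'I : ∀ j, H' j ∈ I := fun j => hI _ fun x hx => hx.1.1.1 j
    have hg'I : ∀ b, g' b ∈ I := by
      intro b
      induction b using Fin.addCases with
      | left b =>
        simp only [g', Fin.append_left, ← hgI]
        exact Submodule.subset_span (mem_range_self b)
      | right j => simpa only [g', Fin.append_right] using hH'I j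
    have hg'span : I ≤ Ideal.span (range g') := by
      rw [← hgI]
      refine Submodule.span_mono ?_
      rintro _ ⟨b, rfl⟩
      exact ⟨Fin.castAdd r b, Fin.append_left _ _ _⟩
    obtain ⟨x, hxT, hmax⟩ : ∃ x ∈ T, ∀ y ∈ T,
        Module.finrank K (differentialSpan (Sum.elim g' F') y) ≤
        Module.finrank K (differentialSpan (Sum.elim g' F') x) := by
      set rk : U → ℕ := fun y =>
        Module.finrank K (differentialSpan (Sum.elim g' F') y)
      have hbdd : BddAbove (rk '' T) := by
        refine ⟨n, ?_⟩
        rintro _ ⟨y, -, rfl⟩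
        exact (Submodule.finrank_le _).trans (by simp)
      obtain ⟨x, hxT, hx⟩ := Nat.sSup_mem (hTne.image rk) hbdd
      refine ⟨x, hxT, fun y hy => ?_⟩
      change rk y ≤ rk x
      rw [hx]
      exact le_csSup hbdd (mem_image_of_mem rk hy)
    obtain ⟨p, Φ, l, d, hdx, hΦ, hS⟩ := hM.exists_isClosedSystem g' F' T
      (fun φ hφ => hg'span (hI φ hφ)) hmax (fun hall => not_forall_of_mem_singularPoints hxT.1 fun y => by
        obtain ⟨w, hw, hwF⟩ := hall y
        refine ⟨w, fun j => ?_, hwF⟩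
        simpa only [g', Fin.append_right] using hw (Fin.natAdd q j))
    have hmeager := hS.definablyMeager hc hUdef hUopen hM (fun b => (g' b).2) d.2 hF hΦ
    -- `d` is not in `I` because it is nonzero at the point `x` of `T`; so the induction hypothesis
    -- covers the part of `T` where `d = 0`.
    refine (hmeager.union (hsup d fun hdI => hdx (hxT.2 d hdI))).mono ?_
    rintro _ ⟨y, hy, rfl⟩
    by_cases hdy : (d : U → K) y = 0
    · exact Or.inr ⟨y, ⟨hy, hdy⟩, rfl⟩
    · exact Or.inl ⟨y, ⟨fun b => hy.2 _ (hg'I b), hdy⟩, rfl⟩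
  refine (claim ⊥).mono (image_mono ?_)
  refine fun x hx => ⟨hx, fun φ hφ => ?_⟩
  rw [(Submodule.mem_bot _).1 hφ]
  rfl

end Main

end DefBaire

theorem mainTheorem8 (L : FirstOrder.Language.{u, v}) (K : Type w)
    [Field K] [LinearOrder K] [IsStrictOrderedRing K] [TopologicalSpace K] [OrderTopology K]
    [L.Structure K] (hK : DefBaire.ExpandsOrderedField L K)
    (hcomplete : DefBaire.DefinablyComplete L K) (hBaire : DefBaire.DefinablyBaire L K)
    (n : ℕ) (hn : n ≠ 0) (U : Set (Fin n → K)) (hUdef : DefBaire.IsDefinable L U)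
    (hUopen : IsOpen U) (hUconn : DefBaire.DefinablyConnected L U)
    (M : Subring (U → K)) (hM : DefBaire.IsNoetherianDifferentialRing L M)
    (k m : ℕ) (hk : k ≤ n)
    (H : Fin (n - k) → U → K) (hH : ∀ j, H j ∈ M) (hV : (DefBaire.regularZeros H).Nonempty)
    (F : Fin m → U → K) (hF : ∀ j, F j ∈ M) :
    DefBaire.DefinablyMeager L (DefBaire.singularValues H F) :=
  have : Fact (DefBaire.ExpandsOrderedField L K) := ⟨hK⟩
  hcomplete.definablyMeager_singularValues hUdef hUopen hM hH hF
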